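/- Let $\mathfrak g$ be a finite-dimensional complex semisimple Lie algebra with a Cartan subalgebra $\mathfrak h$, a choice of simple roots with simple coroots $h_1,\dots,h_r$, and $\mathfrak n_+$ the sum of the root spaces of the positive roots. Let $A$ be a finitely generated commutative unital $\mathbb C$-algebra (for example the algebra of functions on a complex affine variety $M$, possibly singular). A point is a $\mathbb C$-algebra homomorphism $z\colon A\to\mathbb C$ (equivalently an ideal of codimension one), and we write $P(z)$ for $z(P)$. Let $\lambda\in\mathfrak h^*$ be a dominant integral weight, so that $\lambda_i=\lambda(h_i)\in\mathbb Z_{\ge 0}$, and let $\{\mathcal Z\}_\lambda=(\mathcal Z^{(i)}_j)_{1\le i\le r,\ 1\le j\le\lambda_i}$ be a $\lambda$-multiset, i.e. a family of points, not necessarily distinct. A $\mathfrak g\otimes A$-module $V$ is called integrable if, for some finite set $D$ of integral weights, $V=\bigoplus_{\mu\in D}V^\mu$, where $h\otimes 1$ acts on $V^\mu$ by $\mu(h)$ for all $h\in\mathfrak h$. The local Weyl module $W_M(\{\mathcal Z\}_\lambda)$ is the maximal integrable $\mathfrak g\otimes A$-module generated by a vector $v$ such that $$(x\otimes P)\,v=0,\qquad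 (h_i\otimes P)\,v=\Big(\sum_{j=1}^{\lambda_i}P(\mathcal Z^{(i)}_j)\Big)v\qquad\text{for all } x\in\mathfrak n_+,\ P\in A,\ i=1,\dots,r;$$ maximal means that for every other integrable module generated by a vector $v'$ with these relations there is a surjective homomorphism from $W_M(\{\mathcal Z\}_\lambda)$ onto it that takes $v$ to $v'$. It is realised as the quotient of the universal enveloping algebra $U(\mathfrak g\otimes A)$ by the intersection of all left ideals that contain the elements expressing the above relations and have an integrable quotient, with $v$ the class of $1$. Theorem. The module $W_M(\{\mathcal Z\}_\lambda)$ so constructed has this maximality property (so the local Weyl module exists), and it is finite-dimensional. -/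

import Mathlib

open scoped TensorProduct

universe w

namespace WeylModules

open LieAlgebra LieAlgebra.IsKilling Module

/-! ### Modules given by left ideals of the universal enveloping algebra -/

section Cyclic

variable {L : Type*} [LieRing L] [LieAlgebra ℂ L]

/-- The cyclic `L`-module `U(L) / K`, for a left ideal `K` of the enveloping algebra `U(L)`. -/
def CyclicModule (K : Submodule (UniversalEnvelopingAlgebra ℂ L) (UniversalEnvelopingAlgebra ℂ L)) :
    Type _ :=
  UniversalEnvelopingAlgebra ℂ L ⧸ K

namespace CyclicModule

variable (K : Submodule (UniversalEnvelopingAlgebra ℂ L) (UniversalEnvelopingAlgebra ℂ L))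

noncomputable instance : AddCommGroup (CyclicModule K) :=
  inferInstanceAs (AddCommGroup (UniversalEnvelopingAlgebra ℂ L ⧸ K))

noncomputable instance : Module (UniversalEnvelopingAlgebra ℂ L) (CyclicModule K) :=
  inferInstanceAs (Module (UniversalEnvelopingAlgebra ℂ L) (UniversalEnvelopingAlgebra ℂ L ⧸ K))

noncomputable instance : Module ℂ (CyclicModule K) :=
  inferInstanceAs (Module ℂ (UniversalEnvelopingAlgebra ℂ L ⧸ K))

instance : IsScalarTower ℂ (UniversalEnvelopingAlgebra ℂ L) (CyclicModule K) :=
  inferInstanceAs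
    (IsScalarTower ℂ (UniversalEnvelopingAlgebra ℂ L) (UniversalEnvelopingAlgebra ℂ L ⧸ K))

/-- An element `x` of `L` acts on `U(L) / K` by left multiplication by its image in `U(L)`. -/
noncomputable instance : LieRingModule L (CyclicModule K) where
  bracket x m := UniversalEnvelopingAlgebra.ι ℂ x • m
  add_lie x y m := by simp only [map_add, add_smul]
  lie_add x m n := by simp only [smul_add]
  leibniz_lie x y m := by
    simp only [LieHom.map_lie, LieRing.of_associative_ring_bracket, sub_smul, mul_smul]
    abel

noncomputable instance : LieModule ℂ L (CyclicModule K) where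
  smul_lie t x m := by
    change UniversalEnvelopingAlgebra.ι ℂ (t • x) • m = t • (UniversalEnvelopingAlgebra.ι ℂ x • m)
    rw [map_smul, smul_assoc]
  lie_smul t x m := by
    change UniversalEnvelopingAlgebra.ι ℂ x • (t • m) = t • (UniversalEnvelopingAlgebra.ι ℂ x • m)
    rw [← algebraMap_smul (UniversalEnvelopingAlgebra ℂ L) t m, ← mul_smul,
      ← algebraMap_smul (UniversalEnvelopingAlgebra ℂ L) t, ← mul_smul, Algebra.commutes]

/-- The class of `1`, which generates `U(L) / K`. -/
noncomputable def gen : CyclicModule K :=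
  Submodule.Quotient.mk (p := K) 1

end CyclicModule

end Cyclic

variable {g : Type*} [LieRing g] [LieAlgebra ℂ g] [FiniteDimensional ℂ g] [IsKilling ℂ g]
  {H : LieSubalgebra ℂ g} [H.IsCartanSubalgebra]
  {A : Type*} [CommRing A] [Algebra ℂ A]

/-! ### Weights -/

variable (H) in
/-- The weight lattice `P`: the functionals on `H` with integer values on all coroots. -/
def weightLattice : Set (Dual ℂ H) :=
  {μ | ∀ α : H.root, ∃ n : ℤ, μ ((rootSystem H).coroot α) = n}

/-- `λ` is dominant (integral): each `λ (h_i)`, `h_i` a simple coroot, is a non-negative integer. -/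
def IsDominant (b : (rootSystem H).Base) (lam : Dual ℂ H) : Prop :=
  ∀ i : b.support, ∃ n : ℕ, lam ((rootSystem H).coroot i) = n

/-- The nilpotent radical `𝔫₊` of the Borel subalgebra attached to the base `b`: the sum of the
root spaces of the positive roots. -/
noncomputable def nPlus (b : (rootSystem H).Base) : Submodule ℂ g :=
  ⨆ (α : H.root) (_ : b.IsPos α), (rootSpace H (α : LieModule.Weight ℂ H g)).toSubmodule

/-! ### Integrable modules over the current algebra `A ⊗ g` -/

section Integrable

variable (H A) (V : Type*) [AddCommGroup V] [Module ℂ V] [LieRingModule (A ⊗[ℂ] g) V]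
  [LieModule ℂ (A ⊗[ℂ] g) V]

/-- The weight space `V^μ` for the action of the Cartan subalgebra `1 ⊗ H`. -/
noncomputable def weightSpace (μ : Dual ℂ H) : Submodule ℂ V where
  carrier := {v | ∀ h : H, ⁅(1 : A) ⊗ₜ[ℂ] (h : g), v⁆ = μ h • v}
  zero_mem' h := by simp
  add_mem' ha hb h := by rw [lie_add, ha h, hb h, smul_add]
  smul_mem' c v hv h := by rw [lie_smul, hv h, smul_comm]

open Classical in
/-- An `A ⊗ g`-module is integrable over `1 ⊗ g` if it is the direct sum of the weight spaces
`V^μ`, `μ ∈ D`, for some finite subset `D` of the weight lattice. -/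
def IsIntegrable : Prop :=
  ∃ D : Finset (Dual ℂ H), (D : Set (Dual ℂ H)) ⊆ weightLattice H ∧
    DirectSum.IsInternal (fun μ : D ↦ weightSpace H A V (μ : Dual ℂ H))

end Integrable

/-! ### Local Weyl modules -/

variable (A) in
/-- A `λ`-multiset: for each simple root `α_i` a family of `λ_i = λ (h_i)` points, not necessarily
distinct. A point of the variety with coordinate algebra `A` is a `ℂ`-algebra homomorphism
`z : A → ℂ` (equivalently its kernel, an ideal of codimension one), and `P(z) = z P`. -/
structure LambdaMultiset (b : (rootSystem H).Base) (lam : Dual ℂ H) where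
  /-- the non-negative integer `λ_i = λ (h_i)` -/
  coord : b.support → ℕ
  apply_coroot : ∀ i : b.support, lam ((rootSystem H).coroot i) = coord i
  /-- the points attached to the `i`-th simple root -/
  point : ∀ i : b.support, Fin (coord i) → (A →ₐ[ℂ] ℂ)

namespace LambdaMultiset

variable {b : (rootSystem H).Base} {lam : Dual ℂ H} (Z : LambdaMultiset A b lam)

/-- The scalar `∑ⱼ P(z_j^{(i)})`. -/
noncomputable def scalar (i : b.support) (P : A) : ℂ :=
  ∑ j : Fin (Z.coord i), Z.point i j P

/-- `V` is an integrable `A ⊗ g`-module generated by a vector `v` that is killed by `P ⊗ 𝔫₊` and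
satisfies `(P ⊗ h_i) v = (∑ⱼ P(z_j^{(i)})) v`, for all `P ∈ A` and all simple coroots `h_i`. -/
structure IsWeylQuotient (V : Type*) [AddCommGroup V] [Module ℂ V] [LieRingModule (A ⊗[ℂ] g) V]
    [LieModule ℂ (A ⊗[ℂ] g) V] (v : V) : Prop where
  integrable : IsIntegrable H A V
  lieSpan_eq_top : LieSubmodule.lieSpan ℂ (A ⊗[ℂ] g) {v} = ⊤
  nPlus_lie : ∀ (P : A), ∀ x ∈ nPlus b, ⁅P ⊗ₜ[ℂ] x, v⁆ = 0
  coroot_lie : ∀ (i : b.support) (P : A),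
    ⁅P ⊗ₜ[ℂ] ((rootSystem H).coroot i : g), v⁆ = Z.scalar i P • v

/-- The defining property of the local Weyl module: `W` is the maximal integrable module generated
by a vector `v` with the above relations, that is, every other such module is a quotient of it. -/
structure IsLocalWeylModule.{w₀, w', u, u'} {g : Type u} [LieRing g] [LieAlgebra ℂ g]
    [FiniteDimensional ℂ g] [IsKilling ℂ g] {H : LieSubalgebra ℂ g} [H.IsCartanSubalgebra]
    {A : Type u'} [CommRing A] [Algebra ℂ A] {b : (rootSystem H).Base} {lam : Dual ℂ H}
    (Z : LambdaMultiset A b lam) (W : Type w') [AddCommGroup W] [Module ℂ W]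
    [LieRingModule (A ⊗[ℂ] g) W] [LieModule ℂ (A ⊗[ℂ] g) W] (v : W) : Prop where
  isWeylQuotient : Z.IsWeylQuotient W v
  maximal : ∀ (V : Type w₀) [AddCommGroup V] [Module ℂ V] [LieRingModule (A ⊗[ℂ] g) V]
    [LieModule ℂ (A ⊗[ℂ] g) V] (u : V), Z.IsWeylQuotient V u →
      ∃ φ : W →ₗ⁅ℂ, A ⊗[ℂ] g⁆ V, Function.Surjective φ ∧ φ v = u

/-- The left ideal of `U(A ⊗ g)` generated by the defining relations; the quotient by it is the
module induced from the one-dimensional module of the Borel subalgebra. -/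
noncomputable def relationIdeal : Submodule (UniversalEnvelopingAlgebra ℂ (A ⊗[ℂ] g))
    (UniversalEnvelopingAlgebra ℂ (A ⊗[ℂ] g)) :=
  Submodule.span _
    ({u | ∃ (P : A), ∃ x ∈ nPlus b, u = UniversalEnvelopingAlgebra.ι ℂ (P ⊗ₜ[ℂ] x)} ∪
     {u | ∃ (i : b.support) (P : A),
        u = UniversalEnvelopingAlgebra.ι ℂ (P ⊗ₜ[ℂ] ((rootSystem H).coroot i : g)) -
          algebraMap ℂ _ (Z.scalar i P)})

/-- The intersection of all left ideals that contain the relations and have an integrable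
quotient. -/
noncomputable def weylIdeal : Submodule (UniversalEnvelopingAlgebra ℂ (A ⊗[ℂ] g))
    (UniversalEnvelopingAlgebra ℂ (A ⊗[ℂ] g)) :=
  sInf {K | Z.relationIdeal ≤ K ∧ IsIntegrable H A (CyclicModule K)}

/-- The local Weyl module: the maximal integrable quotient of the induced module. -/
abbrev LocalWeylModule : Type _ := CyclicModule Z.weylIdeal

end LambdaMultiset

end WeylModules

namespace WeylModules

open LieAlgebra LieAlgebra.IsKilling Module

variable {g : Type*} [LieRing g] [LieAlgebra ℂ g] [FiniteDimensional ℂ g] [IsKilling ℂ g]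
  {H : LieSubalgebra ℂ g} [H.IsCartanSubalgebra]
  {A : Type*} [CommRing A] [Algebra ℂ A]

/-! ### Weight spaces -/

section WeightSpaces

variable {V : Type*} [AddCommGroup V] [Module ℂ V] [LieRingModule (A ⊗[ℂ] g) V]
  [LieModule ℂ (A ⊗[ℂ] g) V]

/-! Existence needs a bound on weights that is uniform over all integrable quotients of the induced
module. If `V` is integrable and generated by a highest weight vector of weight `lam`, every weight
`μ` lies in `lam` minus the cone of the simple roots, and `sl₂` theory makes the set of weights
stable under the Weyl group `W`. Since `∑ w • μ = 0`, one gets `|W| • lam - (lam - μ) = ∑_{w ≠ 1}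
(lam - w • μ)`, which again lies in the cone. So `lam - μ` ranges over a finite interval that
depends only on `lam` (`mem_weightBound`, `finite_weightBound`). A weight vector of any other weight
in `U / weylIdeal` dies in each `U / K`, hence is zero, and `U / weylIdeal` is integrable.
Maximality follows: the annihilator of the generator of a competing module is one of the ideals
being intersected.

For finite-dimensionality, take a positive root `α` with triple `e, f, h`. As `1 ⊗ f` is nilpotent
on `v`, applying a power of `P ⊗ e` to `(1 ⊗ f) ^ (n + 1) v = 0` gives a monic `p` with `(p(P) ⊗ f)
v = 0` (`exists_monic_aeval_tmul_lie_eq_zero`). The `P` with `(P ⊗ f) v = 0` form an ideal; let `J`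
be the intersection of these ideals over the positive roots. Then `A / J` is integral and of finite
type over `ℂ`, hence finite-dimensional, and `J ⊗ g` kills `V` (`exists_ideal`). So `V` is a module
over a quotient of the finite-dimensional `(A / J) ⊗ g`. Products of `k` lowering operators applied
to `v` span a finite-dimensional space, which vanishes for large `k` because there are finitely many
weights. -/

lemma tmul_lie_tmul_lie {g A V : Type*} [LieRing g] [LieAlgebra ℂ g] [CommRing A] [Algebra ℂ A]
    [AddCommGroup V] [LieRingModule (A ⊗[ℂ] g) V] (P Q : A) (x y : g) (v : V) :
    ⁅P ⊗ₜ[ℂ] x, ⁅Q ⊗ₜ[ℂ] y, v⁆⁆ =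
      ⁅(P * Q) ⊗ₜ[ℂ] ⁅x, y⁆, v⁆ + ⁅Q ⊗ₜ[ℂ] y, ⁅P ⊗ₜ[ℂ] x, v⁆⁆ := by
  rw [leibniz_lie, LieAlgebra.ExtendScalars.bracket_tmul]

lemma tmul_lie_mem_weightSpace {χ μ : Dual ℂ H} {x : g} (hx : x ∈ rootSpace H χ) (P : A) {v : V}
    (hv : v ∈ weightSpace H A V μ) : ⁅P ⊗ₜ[ℂ] x, v⁆ ∈ weightSpace H A V (μ + χ) := by
  intro h
  have h1 : ⁅(h : g), x⁆ = χ h • x := lie_eq_smul_of_mem_rootSpace hx h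
  rw [tmul_lie_tmul_lie, hv h, h1, one_mul, TensorProduct.tmul_smul, smul_lie, lie_smul,
    LinearMap.add_apply, add_smul, add_comm]

/-- `H` is abelian, so the operators `1 ⊗ h` commute and their joint generalized eigenspaces are
independent; the weight spaces sit inside these. -/
lemma iSupIndep_weightSpace : iSupIndep (weightSpace H A V) := by
  let φ : H → Module.End ℂ V := fun h ↦ LieModule.toEnd ℂ (A ⊗[ℂ] g) V ((1 : A) ⊗ₜ[ℂ] (h : g))
  have hcomm (i j : H) : Commute (φ i) (φ j) := by
    ext v
    have h0 : ⁅(i : g), (j : g)⁆ = 0 := by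
      rw [← LieSubalgebra.coe_bracket, trivial_lie_zero]; rfl
    have := tmul_lie_tmul_lie (1 : A) 1 (i : g) (j : g) v
    simpa [h0, φ] using this
  have key := Module.End.independent_iInf_maxGenEigenspace_of_forall_mapsTo φ
    fun i j c ↦ Module.End.mapsTo_maxGenEigenspace_of_comm (hcomm j i) c
  refine (key.comp (f := fun μ : Dual ℂ H ↦ (μ : H → ℂ)) DFunLike.coe_injective).mono ?_
  intro μ v hv
  simp only [Function.comp_apply, Submodule.mem_iInf]
  exact fun h ↦ (φ h).genEigenspace_le_maximal (μ h) 1 |>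
    fun hle ↦ hle (by simpa [Module.End.mem_eigenspace_iff, φ] using hv h)

lemma mem_of_weightSpace_ne_bot {S : Set (Dual ℂ H)}
    (hS : ⨆ μ ∈ S, weightSpace H A V μ = ⊤) {μ : Dual ℂ H} (hμ : weightSpace H A V μ ≠ ⊥) :
    μ ∈ S := by
  by_contra hn
  refine hμ ?_
  have := (iSupIndep_weightSpace (H := H) (A := A) (V := V)).disjoint_biSup hn
  rwa [hS, disjoint_top] at this

/-- Independence being automatic, only the spanning condition remains to be checked. -/
lemma isIntegrable_iff : IsIntegrable H A V ↔ ∃ D : Set (Dual ℂ H), D.Finite ∧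
    D ⊆ weightLattice H ∧ ⨆ μ ∈ D, weightSpace H A V μ = ⊤ := by
  classical
  constructor
  · rintro ⟨D, hD, h⟩
    refine ⟨D, D.finite_toSet, hD, ?_⟩
    have := h.submodule_iSup_eq_top
    rwa [iSup_subtype] at this
  · rintro ⟨D, hfin, hD, h⟩
    refine ⟨hfin.toFinset, by simpa using hD, ?_⟩
    convert (DirectSum.isInternal_submodule_iff_iSupIndep_and_iSup_eq_top _).mpr ⟨?_, ?_⟩
    · exact iSupIndep_weightSpace.comp Subtype.val_injective
    · rw [iSup_subtype]
      simpa using h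

end WeightSpaces

/-! ### Weyl group invariance of the weights -/

section WeylInvariance

variable {V : Type*} [AddCommGroup V] [Module ℂ V] [LieRingModule (A ⊗[ℂ] g) V]
  [LieModule ℂ (A ⊗[ℂ] g) V]

lemma pow_toEnd_mem_weightSpace {χ μ : Dual ℂ H} {x : g} (hx : x ∈ rootSpace H χ) (P : A) {v : V}
    (hv : v ∈ weightSpace H A V μ) (n : ℕ) :
    (LieModule.toEnd ℂ (A ⊗[ℂ] g) V (P ⊗ₜ[ℂ] x) ^ n) v ∈ weightSpace H A V (μ + n • χ) := by
  induction n with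
  | zero => simpa using hv
  | succ n ih =>
    rw [pow_succ', Module.End.mul_apply, succ_nsmul, ← add_assoc]
    exact tmul_lie_mem_weightSpace hx P ih

/-- In an integrable module a nonzero root acts nilpotently on every weight vector. -/
lemma IsIntegrable.exists_pow_eq_zero (hV : IsIntegrable H A V) {χ μ : Dual ℂ H} (hχ : χ ≠ 0)
    {x : g} (hx : x ∈ rootSpace H χ) (P : A) {v : V} (hv : v ∈ weightSpace H A V μ) :
    ∃ n, (LieModule.toEnd ℂ (A ⊗[ℂ] g) V (P ⊗ₜ[ℂ] x) ^ n) v = 0 := by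
  obtain ⟨D, hfin, -, hD⟩ := isIntegrable_iff.mp hV
  by_contra! hcon
  have hinj : Function.Injective fun n : ℕ ↦ μ + n • χ := fun m n h ↦ by
    simpa [← Nat.cast_smul_eq_nsmul ℂ, hχ] using h
  refine Set.infinite_of_injective_forall_mem hinj (s := D) (fun n ↦ ?_) hfin
  refine mem_of_weightSpace_ne_bot hD fun h ↦ hcon n ?_
  simpa [h] using pow_toEnd_mem_weightSpace hx P hv n

lemma lie_e_pow_f {g A V : Type*} [LieRing g] [LieAlgebra ℂ g] [CommRing A] [Algebra ℂ A]
    [AddCommGroup V] [Module ℂ V] [LieRingModule (A ⊗[ℂ] g) V] [LieModule ℂ (A ⊗[ℂ] g) V]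
    {e f h : g} (hef : ⁅e, f⁆ = h) (hhf : ⁅h, f⁆ = -(2 : ℂ) • f) {c : ℂ} {w : V}
    (he : ⁅(1 : A) ⊗ₜ[ℂ] e, w⁆ = 0) (hh : ⁅(1 : A) ⊗ₜ[ℂ] h, w⁆ = c • w) (n : ℕ) :
    ⁅(1 : A) ⊗ₜ[ℂ] e, (LieModule.toEnd ℂ (A ⊗[ℂ] g) V ((1 : A) ⊗ₜ[ℂ] f) ^ (n + 1)) w⁆ =
      ((n + 1) * (c - n)) • (LieModule.toEnd ℂ (A ⊗[ℂ] g) V ((1 : A) ⊗ₜ[ℂ] f) ^ n) w := by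
  have hw (n : ℕ) : ⁅(1 : A) ⊗ₜ[ℂ] h, (LieModule.toEnd ℂ (A ⊗[ℂ] g) V ((1 : A) ⊗ₜ[ℂ] f) ^ n) w⁆ =
      (c - 2 * n) • (LieModule.toEnd ℂ (A ⊗[ℂ] g) V ((1 : A) ⊗ₜ[ℂ] f) ^ n) w := by
    induction n with
    | zero => simpa using hh
    | succ n ih =>
      rw [pow_succ', Module.End.mul_apply, LieModule.toEnd_apply_apply, tmul_lie_tmul_lie, ih, hhf,
        one_mul, TensorProduct.tmul_smul, smul_lie, lie_smul, ← add_smul]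
      congr 1
      push_cast
      ring
  induction n with
  | zero => simp [tmul_lie_tmul_lie, hef, he, hh]
  | succ n ih =>
    rw [pow_succ', Module.End.mul_apply, LieModule.toEnd_apply_apply, tmul_lie_tmul_lie, hef,
      one_mul, ih, hw, lie_smul, ← LieModule.toEnd_apply_apply ℂ (A ⊗[ℂ] g) V ((1 : A) ⊗ₜ[ℂ] f),
      ← Module.End.mul_apply, ← pow_succ', ← add_smul]
    congr 1
    push_cast
    ring

/-- Raise a vector of weight `μ` by `e` until the next step kills it, after `a` steps say. The
result `u'` has `h`-eigenvalue `q + 2a`, so `f ^ n u'` is nonzero for all `n ≤ q + 2a`. -/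
lemma weightSpace_sub_nsmul_ne_bot (hV : IsIntegrable H A V) {χ μ : Dual ℂ H} {e f : g} {h : H}
    (he : e ∈ rootSpace H χ) (hf : f ∈ rootSpace H (-χ : Dual ℂ H)) (hef : ⁅e, f⁆ = h)
    (hχ : χ h = 2) {q : ℕ} (hq : μ h = q) (hμ : weightSpace H A V μ ≠ ⊥) :
    weightSpace H A V (μ - q • χ) ≠ ⊥ := by
  have hχ0 : χ ≠ 0 := by rintro rfl; simp at hχ
  obtain ⟨u, hu, hu0⟩ := (Submodule.ne_bot_iff _).mp hμ
  obtain ⟨a, ha, ha'⟩ := Nat.exists_not_and_succ_of_not_zero_of_exists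
    (p := fun n ↦ (LieModule.toEnd ℂ (A ⊗[ℂ] g) V ((1 : A) ⊗ₜ[ℂ] e) ^ n) u = 0)
    (by simpa using hu0) (hV.exists_pow_eq_zero hχ0 he 1 hu)
  have hw := pow_toEnd_mem_weightSpace he (1 : A) hu a
  set u' := (LieModule.toEnd ℂ (A ⊗[ℂ] g) V ((1 : A) ⊗ₜ[ℂ] e) ^ a) u
  have heu : ⁅(1 : A) ⊗ₜ[ℂ] e, u'⁆ = 0 := by
    rw [pow_succ', Module.End.mul_apply] at ha'
    exact ha'
  have hhf : ⁅(h : g), f⁆ = -(2 : ℂ) • f := by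
    have := lie_eq_smul_of_mem_rootSpace hf h
    simpa [hχ] using this
  have key (n : ℕ) (hn : n ≤ q + 2 * a) :
      (LieModule.toEnd ℂ (A ⊗[ℂ] g) V ((1 : A) ⊗ₜ[ℂ] f) ^ n) u' ≠ 0 := by
    induction n with
    | zero => simpa using ha
    | succ n ih =>
      intro h0
      have := lie_e_pow_f hef hhf heu (hw h) n
      rw [h0, lie_zero, eq_comm, smul_eq_zero_iff_left (ih (by omega)), mul_eq_zero] at this
      rcases this with h1 | h1
      · exact Nat.cast_add_one_ne_zero n h1
      · rw [LinearMap.add_apply, LinearMap.smul_apply, hχ, hq, sub_eq_zero, nsmul_eq_mul] at h1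
        have : q + a * 2 = n := by exact_mod_cast h1
        omega
  -- The `a` raising steps are undone and `q` further ones taken: the weight is `μ + a χ - (q + a)
  -- χ`.
  refine (Submodule.ne_bot_iff _).mpr ⟨_, ?_, key (q + a) (by omega)⟩
  convert pow_toEnd_mem_weightSpace hf (1 : A) hw (q + a) using 2
  rw [smul_neg, add_nsmul]
  abel

lemma exists_sl2 (α : H.root) : ∃ e f : g,
    e ∈ rootSpace H ((rootSystem H).root α) ∧ f ∈ rootSpace H (-(rootSystem H).root α : Dual ℂ H) ∧
      ⁅e, f⁆ = ((rootSystem H).coroot α : g) := by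
  obtain ⟨h, e, f, ht, he, hf⟩ := exists_isSl2Triple_of_weight_isNonZero (H.isNonZero_coe_root α)
  refine ⟨e, f, he, hf, ?_⟩
  rw [ht.lie_e_f, ht.h_eq_coroot (H.isNonZero_coe_root α) he hf]
  rfl

lemma weightSpace_reflection_ne_bot (hV : IsIntegrable H A V) (α : H.root) {μ : Dual ℂ H}
    (hμ : weightSpace H A V μ ≠ ⊥) :
    weightSpace H A V ((rootSystem H).reflection α μ) ≠ ⊥ := by
  obtain ⟨D, -, hP, hD⟩ := isIntegrable_iff.mp hV
  obtain ⟨z, hz⟩ := hP (mem_of_weightSpace_ne_bot hD hμ) α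
  obtain ⟨e, f, he, hf, hef⟩ := exists_sl2 α
  have h2 : (rootSystem H).root α ((rootSystem H).coroot α) = 2 :=
    root_apply_coroot (H.isNonZero_coe_root α)
  have hr : (rootSystem H).reflection α μ = μ - (z : ℂ) • (rootSystem H).root α := by
    rw [RootPairing.reflection_apply, ← hz]; rfl
  rw [hr]
  obtain ⟨q, rfl | rfl⟩ := z.eq_nat_or_neg
  · simpa [Nat.cast_smul_eq_nsmul] using
      weightSpace_sub_nsmul_ne_bot hV he hf hef h2 (by simpa using hz) hμ
  -- A negative value on the coroot is treated with the triple of `-α`, in which `e` and `f` change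
  -- places.
  · have := weightSpace_sub_nsmul_ne_bot hV (χ := -(rootSystem H).root α) (q := q)
      (h := -(rootSystem H).coroot α) hf (by simpa using he) (by rw [← lie_skew, hef]; rfl)
      (by simpa using h2) (by rw [map_neg, hz]; simp) hμ
    simpa [Nat.cast_smul_eq_nsmul] using this

lemma weightSpace_smul_ne_bot (hV : IsIntegrable H A V) {w : (rootSystem H).Aut}
    (hw : w ∈ (rootSystem H).weylGroup) {μ : Dual ℂ H} (hμ : weightSpace H A V μ ≠ ⊥) :
    weightSpace H A V (w • μ) ≠ ⊥ := by
  induction hw using RootPairing.weylGroup.induction generalizing μ with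
  | mem i => exact weightSpace_reflection_ne_bot hV i hμ
  | one => simpa using hμ
  | mul x y _ _ hx hy => rw [mul_smul]; exact hx (hy hμ)

end WeylInvariance

end WeylModules

namespace WeylModules

open LieAlgebra LieAlgebra.IsKilling Module

variable {g : Type*} [LieRing g] [LieAlgebra ℂ g] [FiniteDimensional ℂ g] [IsKilling ℂ g]
  {H : LieSubalgebra ℂ g} [H.IsCartanSubalgebra]
  {A : Type*} [CommRing A] [Algebra ℂ A]

/-! ### The cone generated by the simple roots -/

section Cone

variable (b : (rootSystem H).Base)

/-- The additive monoid generated by the simple roots. -/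
def posCone : AddSubmonoid (Dual ℂ H) :=
  AddSubmonoid.closure ((rootSystem H).root '' b.support)

/-- The linear functional taking the value `1` on all simple roots. -/
noncomputable def heightFunctional : Dual ℂ H →ₗ[ℂ] ℂ :=
  b.toWeightBasis.constr ℂ fun _ ↦ (1 : ℂ)

lemma heightFunctional_root {i : H.root} (hi : i ∈ b.support) :
    heightFunctional b ((rootSystem H).root i) = 1 := by
  have := b.toWeightBasis.constr_basis ℂ (fun _ ↦ (1 : ℂ)) ⟨i, hi⟩
  rwa [RootPairing.Base.toWeightBasis_apply] at this

variable {b}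

lemma eq_zero_or_heightFunctional_eq {γ : Dual ℂ H} (hγ : γ ∈ posCone b) :
    γ = 0 ∨ ∃ n : ℕ, heightFunctional b γ = (n + 1 : ℕ) := by
  induction hγ using AddSubmonoid.closure_induction with
  | mem x hx =>
    obtain ⟨i, hi, rfl⟩ := hx
    exact Or.inr ⟨0, by simpa using heightFunctional_root b hi⟩
  | zero => exact Or.inl rfl
  | add x y _ _ hx hy =>
    rcases hx with rfl | ⟨m, hm⟩
    · simpa using hy
    rcases hy with rfl | ⟨n, hn⟩
    · exact Or.inr ⟨m, by simpa using hm⟩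
    · exact Or.inr ⟨m + n + 1, by rw [map_add, hm, hn]; push_cast; ring⟩

lemma exists_repr_eq_nat {γ : Dual ℂ H} (hγ : γ ∈ posCone b) (i : b.support) :
    ∃ n : ℕ, b.toWeightBasis.repr γ i = n := by
  induction hγ using AddSubmonoid.closure_induction with
  | mem x hx =>
    obtain ⟨j, hj, rfl⟩ := hx
    classical
    have := b.toWeightBasis_repr_root ⟨j, hj⟩
    rw [this, Finsupp.single_apply]
    split_ifs
    exacts [⟨1, by simp⟩, ⟨0, by simp⟩]
  | zero => exact ⟨0, by simp⟩
  | add x y _ _ hx hy =>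
    obtain ⟨m, hm⟩ := hx
    obtain ⟨n, hn⟩ := hy
    exact ⟨m + n, by simp [hm, hn]⟩

/-- In the basis of simple roots, the coordinates of `γ` are natural numbers bounded by those of
`c`. The bound is phrased with the norm because the coordinates of `c` are a priori complex. -/
lemma finite_posCone_interval (c : Dual ℂ H) :
    {γ | γ ∈ posCone b ∧ c - γ ∈ posCone b}.Finite := by
  let T (z : ℂ) : Set ℂ := Nat.cast '' Set.Iic ⌊‖z‖⌋₊
  have hT (z : ℂ) : (T z).Finite := (Set.finite_Iic _).image _
  refine Set.Finite.of_finite_image (f := b.toWeightBasis.equivFun)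
    ((Set.Finite.pi' fun i ↦ hT (b.toWeightBasis.repr c i)).subset ?_)
    b.toWeightBasis.equivFun.injective.injOn
  rintro _ ⟨γ, ⟨h1, h2⟩, rfl⟩ i
  obtain ⟨m, hm⟩ := exists_repr_eq_nat h1 i
  obtain ⟨n, hn⟩ := exists_repr_eq_nat h2 i
  rw [map_sub, Finsupp.sub_apply, hm, sub_eq_iff_eq_add] at hn
  refine ⟨m, ?_, by simp [hm]⟩
  rw [Set.mem_Iic, hn, Nat.le_floor_iff (norm_nonneg _), ← Nat.cast_add, Complex.norm_natCast]
  exact_mod_cast Nat.le_add_left m n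

lemma isPos_or_neg_root_mem_posCone (α : H.root) :
    b.IsPos α ∨ -(rootSystem H).root α ∈ posCone b := by
  obtain ⟨f, -, hf | hf⟩ := b.exists_root_eq_sum_nat_or_neg α
  · left
    have := RootPairing.Base.height_eq_sum (b := b) (i := α) (f := fun j ↦ (f j : ℤ))
      (by simp [hf])
    rw [RootPairing.Base.isPos_iff', this]
    positivity
  · right
    rw [hf, neg_neg]
    exact sum_mem fun j hj ↦ nsmul_mem (AddSubmonoid.subset_closure (Set.mem_image_of_mem _ hj)) _

lemma root_mem_weightLattice (α : H.root) : (rootSystem H).root α ∈ weightLattice H := by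
  intro β
  obtain ⟨z, hz⟩ := RootPairing.IsValuedIn.exists_value (P := rootSystem H) (S := ℤ) α β
  exact ⟨z, hz.symm⟩

lemma sub_mem_weightLattice {μ ν : Dual ℂ H} (hμ : μ ∈ weightLattice H)
    (hν : ν ∈ weightLattice H) : μ - ν ∈ weightLattice H := by
  intro α
  obtain ⟨m, hm⟩ := hμ α
  obtain ⟨n, hn⟩ := hν α
  exact ⟨m - n, by rw [LinearMap.sub_apply, hm, hn]; push_cast; rfl⟩

lemma mem_weightLattice_of_mem_posCone {γ : Dual ℂ H} (hγ : γ ∈ posCone b) :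
    γ ∈ weightLattice H := by
  induction hγ using AddSubmonoid.closure_induction with
  | mem x hx =>
    obtain ⟨i, hi, rfl⟩ := hx
    exact root_mem_weightLattice i
  | zero => exact fun _ ↦ ⟨0, by simp⟩
  | add x y _ _ hx hy =>
    intro α
    obtain ⟨m, hm⟩ := hx α
    obtain ⟨n, hn⟩ := hy α
    exact ⟨m + n, by rw [LinearMap.add_apply, hm, hn]; push_cast; rfl⟩

lemma IsDominant.mem_weightLattice {lam : Dual ℂ H} (hlam : IsDominant b lam) :
    lam ∈ weightLattice H := by
  intro α
  have hα := b.coroot_mem_span_int α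
  generalize (rootSystem H).coroot α = x at hα ⊢
  induction hα using Submodule.span_induction with
  | mem x hx =>
    obtain ⟨i, hi, rfl⟩ := hx
    obtain ⟨n, hn⟩ := hlam ⟨i, hi⟩
    exact ⟨n, by simpa using hn⟩
  | zero => exact ⟨0, by simp⟩
  | add x y _ _ hx hy =>
    obtain ⟨m, hm⟩ := hx
    obtain ⟨n, hn⟩ := hy
    exact ⟨m + n, by rw [map_add, hm, hn]; push_cast; rfl⟩
  | smul a x _ hx =>
    obtain ⟨m, hm⟩ := hx
    exact ⟨a * m, by rw [map_zsmul, hm]; simp⟩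

/-! ### Averaging over the Weyl group -/

/-- The roots span, so an automorphism is determined by its permutation of the finitely many roots.
-/
instance : Finite (rootSystem H).Aut := by
  refine Finite.of_injective (RootPairing.Equiv.indexHom (rootSystem H)) fun w w' h ↦ ?_
  refine RootPairing.Equiv.weightHom_injective (rootSystem H) (LinearEquiv.toLinearMap_injective ?_)
  refine LinearMap.ext_on_range (v := (rootSystem H).root)
    RootPairing.IsRootSystem.span_root_eq_top fun i ↦ ?_
  have h1 := RootPairing.Equiv.root_indexEquiv_eq_smul _ i w
  have h2 := RootPairing.Equiv.root_indexEquiv_eq_smul _ i w'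
  have h3 : w.indexEquiv i = w'.indexEquiv i := DFunLike.congr_fun h i
  rw [h3, h2] at h1
  exact h1.symm

/-- The sum is fixed by every reflection, hence vanishes on all coroots, and these span `H`. -/
lemma sum_weylGroup_smul_eq_zero [Fintype (rootSystem H).weylGroup] (μ : Dual ℂ H) :
    ∑ w : (rootSystem H).weylGroup, w • μ = 0 := by
  set s := ∑ w : (rootSystem H).weylGroup, w • μ
  have hs (α : H.root) : s ((rootSystem H).coroot α) = 0 := by
    have h1 : RootPairing.weylGroup.ofIdx (rootSystem H) α • s = s := by
      simp only [s, Finset.smul_sum, smul_smul]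
      exact Fintype.sum_equiv (Equiv.mulLeft (RootPairing.weylGroup.ofIdx (rootSystem H) α)) _ _
        fun _ ↦ rfl
    rw [RootPairing.weylGroup.ofIdx_smul, RootPairing.Equiv.reflection_smul,
      RootPairing.reflection_apply, sub_eq_self, smul_eq_zero] at h1
    exact h1.resolve_right ((rootSystem H).ne_zero α)
  refine LinearMap.ext_on_range (v := (rootSystem H).coroot)
    RootPairing.IsRootSystem.span_coroot_eq_top fun i ↦ ?_
  simpa using hs i

end Cone

/-! ### Highest weight modules -/

section HighestWeight

variable {V : Type*} [AddCommGroup V] [Module ℂ V] [LieRingModule (A ⊗[ℂ] g) V]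
  [LieModule ℂ (A ⊗[ℂ] g) V] {b : (rootSystem H).Base} {lam : Dual ℂ H}

/-- `V` is generated by `v`, a highest weight vector for `A ⊗ 𝔟₊` of weight `lam` over `1 ⊗ H`. -/
structure IsHighestWeightGenerator (b : (rootSystem H).Base) (lam : Dual ℂ H) (v : V) : Prop where
  lieSpan_eq_top : LieSubmodule.lieSpan ℂ (A ⊗[ℂ] g) {v} = ⊤
  nPlus_lie : ∀ (P : A), ∀ x ∈ nPlus b, ⁅P ⊗ₜ[ℂ] x, v⁆ = 0
  cartan_lie : ∀ (P : A) (h : H), ∃ c : ℂ, ⁅P ⊗ₜ[ℂ] (h : g), v⁆ = c • v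
  mem_weightSpace : v ∈ weightSpace H A V lam

variable (A b) in
/-- The span of the elements `P ⊗ x`, with `x` in the root space of a negative root. -/
noncomputable def nMinus : Submodule ℂ (A ⊗[ℂ] g) :=
  Submodule.span ℂ {y | ∃ (P : A) (γ : Dual ℂ H) (x : g), γ ∈ posCone b ∧ γ ≠ 0 ∧
    x ∈ rootSpace H (-γ : Dual ℂ H) ∧ y = P ⊗ₜ[ℂ] x}

variable (A b) in
/-- The span of the vectors `y₁ ⋯ yₖ v` with `yᵢ` in `A ⊗ 𝔫₋`. -/
noncomputable def level (v : V) : ℕ → Submodule ℂ V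
  | 0 => Submodule.span ℂ {v}
  | k + 1 => Submodule.map₂ (LieModule.toEnd ℂ (A ⊗[ℂ] g) V : A ⊗[ℂ] g →ₗ[ℂ] Module.End ℂ V)
      (nMinus A b) (level v k)

lemma tmul_induction {g A : Type*} [LieRing g] [LieAlgebra ℂ g] [FiniteDimensional ℂ g]
    {H : LieSubalgebra ℂ g} [H.IsCartanSubalgebra] [CommRing A] [Algebra ℂ A]
    {p : A ⊗[ℂ] g → Prop} (h0 : p 0) (hadd : ∀ x y, p x → p y → p (x + y))
    (hroot : ∀ (P : A) (α : LieModule.Weight ℂ H g), ∀ x ∈ rootSpace H α, p (P ⊗ₜ x))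
    (y : A ⊗[ℂ] g) : p y := by
  induction y using TensorProduct.induction_on with
  | zero => exact h0
  | add x y hx hy => exact hadd x y hx hy
  | tmul P x =>
    have hx : x ∈ ⨆ α : LieModule.Weight ℂ H g, (rootSpace H α).toSubmodule := by
      rw [← LieSubmodule.iSup_toSubmodule, LieModule.iSup_genWeightSpace_eq_top' ℂ H g]
      trivial
    induction hx using Submodule.iSup_induction' with
    | mem α x hx => exact hroot P α x hx
    | zero => simpa using h0
    | add x y _ _ hx hy => rw [TensorProduct.tmul_add]; exact hadd _ _ hx hy

variable {v : V}

lemma lie_mem_iSup_level {y : A ⊗[ℂ] g} (hy : y ∈ nMinus A b) {w : V}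
    (hw : w ∈ ⨆ k, level A b v k) : ⁅y, w⁆ ∈ ⨆ k, level A b v k := by
  induction hw using Submodule.iSup_induction' with
  | mem k x hx =>
    exact Submodule.mem_iSup_of_mem (k + 1) (Submodule.apply_mem_map₂ _ hy hx)
  | zero => simp
  | add x z _ _ hx hz => rw [lie_add]; exact add_mem hx hz

/-- This replaces the Poincaré–Birkhoff–Witt theorem. In `l y w = [l, y] w + y l w` the bracket `[l,
y]` is arbitrary, so the induction on `k` quantifies over all of `A ⊗ g`. -/
lemma IsHighestWeightGenerator.iSup_level_eq_top (hv : IsHighestWeightGenerator (A := A) b lam v) :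
    ⨆ k, level A b v k = ⊤ := by
  have hv0 : v ∈ ⨆ k, level A b v k :=
    Submodule.mem_iSup_of_mem 0 (Submodule.mem_span_singleton_self v)
  have key (k : ℕ) : ∀ (l : A ⊗[ℂ] g), ∀ w ∈ level A b v k, ⁅l, w⁆ ∈ ⨆ k, level A b v k := by
    induction k with
    | zero =>
      intro l w hw
      obtain ⟨c, rfl⟩ := Submodule.mem_span_singleton.mp hw
      rw [lie_smul]
      refine Submodule.smul_mem _ _ ?_
      induction l using tmul_induction (H := H) with
      | h0 => simp
      | hadd x y hx hy => rw [add_lie]; exact add_mem hx hy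
      | hroot P α x hx =>
        by_cases hα : α.IsZero
        · have hxH : x ∈ H := by
            rw [hα.eq, rootSpace_zero_eq] at hx
            simpa using hx
          obtain ⟨c, hc⟩ := hv.cartan_lie P ⟨x, hxH⟩
          change ⁅P ⊗ₜ[ℂ] x, v⁆ = c • v at hc
          rw [hc]
          exact Submodule.smul_mem _ _ hv0
        · let i : H.root := ⟨α, by simpa using hα⟩
          rcases isPos_or_neg_root_mem_posCone (b := b) i with h | h
          · rw [hv.nPlus_lie P x]
            · exact zero_mem _
            · exact Submodule.mem_iSup_of_mem i (Submodule.mem_iSup_of_mem h hx)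
          · refine lie_mem_iSup_level (Submodule.subset_span ?_) hv0
            exact ⟨P, _, x, h, neg_ne_zero.mpr ((rootSystem H).ne_zero i),
              by rw [neg_neg]; exact hx, rfl⟩
    | succ k ih =>
      intro l
      suffices level A b v (k + 1) ≤
          (⨆ k, level A b v k).comap (LieModule.toEnd ℂ (A ⊗[ℂ] g) V l) from this
      refine Submodule.map₂_le.mpr fun y hy w hw ↦ ?_
      change ⁅l, ⁅y, w⁆⁆ ∈ ⨆ k, level A b v k
      rw [leibniz_lie]
      exact add_mem (ih _ w hw) (lie_mem_iSup_level hy (ih l w hw))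
  let N : LieSubmodule ℂ (A ⊗[ℂ] g) V :=
    { toSubmodule := ⨆ k, level A b v k
      lie_mem := by
        intro l w hw
        change w ∈ ⨆ k, level A b v k at hw
        change ⁅l, w⁆ ∈ ⨆ k, level A b v k
        induction hw using Submodule.iSup_induction' with
        | mem k x hx => exact key k l x hx
        | zero => simp
        | add x z _ _ hx hz => rw [lie_add]; exact add_mem hx hz }
  have hN : N = ⊤ := by
    rw [eq_top_iff, ← hv.lieSpan_eq_top, LieSubmodule.lieSpan_le, Set.singleton_subset_iff]
    exact hv0
  exact congrArg LieSubmodule.toSubmodule hN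

/-- Each lowering operator subtracts a nonzero element of the cone, whose height is at least `1`. -/
lemma IsHighestWeightGenerator.level_le (hv : IsHighestWeightGenerator (A := A) b lam v) (k : ℕ) :
    level A b v k ≤ ⨆ μ ∈ {μ : Dual ℂ H | lam - μ ∈ posCone b ∧
      ∃ n ≥ k, heightFunctional b (lam - μ) = (n : ℕ)}, weightSpace H A V μ := by
  induction k with
  | zero =>
    rw [level, Submodule.span_singleton_le_iff_mem]
    refine Submodule.mem_iSup_of_mem lam (Submodule.mem_iSup_of_mem ?_ hv.mem_weightSpace)
    exact ⟨by simp, 0, le_rfl, by simp⟩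
  | succ k ih =>
    rw [level, Submodule.map₂_le]
    intro y hy w hw
    replace hw := ih hw
    induction hy using Submodule.span_induction with
    | zero => simp
    | add y z _ _ hy hz => rw [map_add]; exact add_mem hy hz
    | smul c y _ hy => rw [map_smul]; exact Submodule.smul_mem _ _ hy
    | mem y hy =>
      obtain ⟨P, γ, x, hγ, hγ0, hx, rfl⟩ := hy
      induction hw using Submodule.iSup_induction' with
      | zero => simp
      | add x z _ _ hx hz => rw [map_add]; exact add_mem hx hz
      | mem μ u hu =>
        by_cases hμ : μ ∈ {μ : Dual ℂ H | lam - μ ∈ posCone b ∧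
            ∃ n ≥ k, heightFunctional b (lam - μ) = (n : ℕ)}
        · rw [iSup_pos hμ] at hu
          refine Submodule.mem_iSup_of_mem (μ + -γ) (Submodule.mem_iSup_of_mem ?_
            (tmul_lie_mem_weightSpace hx P hu))
          obtain ⟨h1, n, hn, h2⟩ := hμ
          obtain ⟨m, hm⟩ := (eq_zero_or_heightFunctional_eq hγ).resolve_left hγ0
          have h3 : lam - (μ + -γ) = (lam - μ) + γ := by abel
          refine ⟨h3 ▸ add_mem h1 hγ, n + (m + 1), by omega, ?_⟩
          rw [h3, map_add, h2, hm]
          push_cast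
          rfl
        · rw [iSup_neg hμ, Submodule.mem_bot] at hu
          simp [hu]

lemma IsHighestWeightGenerator.iSup_weightSpace_eq_top
    (hv : IsHighestWeightGenerator (A := A) b lam v) :
    ⨆ μ ∈ {μ : Dual ℂ H | lam - μ ∈ posCone b}, weightSpace H A V μ = ⊤ := by
  rw [eq_top_iff, ← hv.iSup_level_eq_top, iSup_le_iff]
  exact fun k ↦ (hv.level_le k).trans (biSup_mono fun μ hμ ↦ hμ.1)

lemma IsHighestWeightGenerator.sub_mem_posCone (hv : IsHighestWeightGenerator (A := A) b lam v)
    {μ : Dual ℂ H} (hμ : weightSpace H A V μ ≠ ⊥) : lam - μ ∈ posCone b :=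
  mem_of_weightSpace_ne_bot hv.iSup_weightSpace_eq_top hμ

/-- A finite set of weights containing all weights of the integrable modules of highest weight
`lam`. -/
def weightBound (b : (rootSystem H).Base) (lam : Dual ℂ H) : Set (Dual ℂ H) :=
  {μ | lam - μ ∈ posCone b ∧
    Nat.card (rootSystem H).weylGroup • lam - (lam - μ) ∈ posCone b}

lemma finite_weightBound : (weightBound b lam).Finite := by
  refine Set.Finite.of_finite_image (f := fun μ ↦ lam - μ) ((finite_posCone_interval (b := b)
    (Nat.card (rootSystem H).weylGroup • lam)).subset ?_) (sub_right_injective.injOn)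
  rintro _ ⟨μ, hμ, rfl⟩
  exact hμ

lemma IsDominant.weightBound_subset (hlam : IsDominant b lam) :
    weightBound b lam ⊆ weightLattice H := by
  intro μ hμ
  have := sub_mem_weightLattice hlam.mem_weightLattice (mem_weightLattice_of_mem_posCone hμ.1)
  rwa [sub_sub_cancel] at this

lemma IsHighestWeightGenerator.mem_weightBound (hv : IsHighestWeightGenerator (A := A) b lam v)
    (hV : IsIntegrable H A V) {μ : Dual ℂ H} (hμ : weightSpace H A V μ ≠ ⊥) :
    μ ∈ weightBound b lam := by
  classical
  have := Fintype.ofFinite (rootSystem H).weylGroup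
  refine ⟨hv.sub_mem_posCone hμ, ?_⟩
  have h1 : Nat.card (rootSystem H).weylGroup • lam =
      ∑ w : (rootSystem H).weylGroup, (lam - w • μ) := by
    rw [Finset.sum_sub_distrib, sum_weylGroup_smul_eq_zero, sub_zero, Finset.sum_const,
      Finset.card_univ, Nat.card_eq_fintype_card]
  rw [h1, ← Finset.add_sum_erase _ _ (Finset.mem_univ 1), one_smul, add_sub_cancel_left]
  exact sum_mem fun w _ ↦ hv.sub_mem_posCone (weightSpace_smul_ne_bot hV w.2 hμ)

end HighestWeight

end WeylModules

namespace WeylModules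

open LieAlgebra LieAlgebra.IsKilling Module

/-! ### An integrality relation for the current algebra of `sl₂` -/

section CurrentSl2

variable {g A V : Type*} [LieRing g] [LieAlgebra ℂ g] [CommRing A] [Algebra ℂ A]
  [AddCommGroup V] [Module ℂ V] [LieRingModule (A ⊗[ℂ] g) V] [LieModule ℂ (A ⊗[ℂ] g) V]

/-- The vector `(P ^ k₁ ⊗ f) ⋯ (P ^ kₙ ⊗ f) v`. -/
def word (P : A) (f : g) (v : V) : List ℕ → V
  | [] => v
  | k :: l => ⁅(P ^ k) ⊗ₜ[ℂ] f, word P f v l⁆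

/-- Combinations of words of length `d` and total exponent at most `s`, paired with the sum of the
coefficients of the words of total exponent exactly `s`. -/
def markedWords (P : A) (f : g) (v : V) (d s : ℕ) : Submodule ℂ (V × ℂ) :=
  Submodule.span ℂ {p | ∃ l : List ℕ, l.length = d ∧ l.sum ≤ s ∧
    p = (word P f v l, if l.sum = s then 1 else 0)}

variable {P : A} {f : g} {v : V}

omit [LieModule ℂ (A ⊗[ℂ] g) V] in
lemma word_mem_markedWords (l : List ℕ) {d s : ℕ} (hd : l.length = d) (hs : l.sum = s) :
    (word P f v l, (1 : ℂ)) ∈ markedWords P f v d s :=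
  Submodule.subset_span ⟨l, hd, hs.le, by simp [hs]⟩

omit [LieModule ℂ (A ⊗[ℂ] g) V] in
lemma word_zero_mem_markedWords (l : List ℕ) {d s : ℕ} (hd : l.length = d) (hs : l.sum < s) :
    (word P f v l, (0 : ℂ)) ∈ markedWords P f v d s :=
  Submodule.subset_span ⟨l, hd, hs.le, by simp [hs.ne]⟩

lemma lie_mem_markedWords {d s : ℕ} {w : V} {c : ℂ} (hw : (w, c) ∈ markedWords P f v d s) (k : ℕ) :
    (⁅(P ^ k) ⊗ₜ[ℂ] f, w⁆, c) ∈ markedWords P f v (d + 1) (s + k) := by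
  suffices markedWords P f v d s ≤ (markedWords P f v (d + 1) (s + k)).comap
      ((LieModule.toEnd ℂ (A ⊗[ℂ] g) V ((P ^ k) ⊗ₜ[ℂ] f)).prodMap LinearMap.id) from this hw
  refine Submodule.span_le.mpr ?_
  rintro _ ⟨l, rfl, hl, rfl⟩
  exact Submodule.subset_span ⟨k :: l, by simp, by simp; omega, by simp [word, add_comm k]⟩

omit [LieModule ℂ (A ⊗[ℂ] g) V] in
lemma markedWords_of_lt {d s s' : ℕ} (hs : s < s') {w : V} {c : ℂ}
    (hw : (w, c) ∈ markedWords P f v d s) : (w, 0) ∈ markedWords P f v d s' := by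
  suffices markedWords P f v d s ≤ (markedWords P f v d s').comap
      (LinearMap.id.prodMap (0 : ℂ →ₗ[ℂ] ℂ)) from this hw
  refine Submodule.span_le.mpr ?_
  rintro _ ⟨l, rfl, hl, rfl⟩
  exact word_zero_mem_markedWords l rfl (hl.trans_lt hs)

variable {e h : g}

/-- Each letter `f` met on the way contributes `-2` to the leading coefficient. On reaching `v`, the
operator becomes a scalar and its exponent is lost; as `a + 1 > 0`, that term is not leading. The
coefficient is carried as a second component since words may be linearly dependent in `V`. -/
lemma h_lie_word_mem (hhf : ⁅h, f⁆ = -(2 : ℂ) • f)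
    (hh : ∀ Q : A, ∃ c : ℂ, ⁅Q ⊗ₜ[ℂ] h, v⁆ = c • v) (a : ℕ) (l : List ℕ) :
    (⁅(P ^ (a + 1)) ⊗ₜ[ℂ] h, word P f v l⁆, -(2 : ℂ) * l.length) ∈
      markedWords P f v l.length (l.sum + (a + 1)) := by
  induction l with
  | nil =>
    obtain ⟨c, hc⟩ := hh (P ^ (a + 1))
    simpa [word, hc] using
      Submodule.smul_mem _ c (word_zero_mem_markedWords (P := P) (f := f) (v := v) []
        (d := 0) (s := a + 1) rfl (by simp))
  | cons k l ih =>
    have h1 := lie_mem_markedWords ih k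
    have h2 := Submodule.smul_mem _ (-(2 : ℂ))
      (word_mem_markedWords (P := P) (f := f) (v := v) ((a + 1 + k) :: l)
        (d := l.length + 1) (s := l.sum + (a + 1) + k) rfl (by simp; omega))
    convert add_mem h2 h1 using 1
    · rw [List.sum_cons, List.length_cons]
      congr 1
      omega
    · ext
      · simp only [word, Prod.smul_mk, Prod.mk_add_mk]
        rw [tmul_lie_tmul_lie, hhf, TensorProduct.tmul_smul, smul_lie, ← pow_add]
      · simp only [List.length_cons, Prod.smul_mk, Prod.mk_add_mk, smul_eq_mul]
        push_cast
        ring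

/-- Commuting `P ⊗ e` past a letter `P ^ k ⊗ f` leaves `P ^ (k + 1) ⊗ h`, which contributes `-2` for
each letter to its right. In total this is `-2 (0 + 1 + ⋯ + (d - 1)) = -d (d - 1)`. -/
lemma e_lie_word_mem (hef : ⁅e, f⁆ = h) (hhf : ⁅h, f⁆ = -(2 : ℂ) • f)
    (he : ⁅P ⊗ₜ[ℂ] e, v⁆ = 0) (hh : ∀ Q : A, ∃ c : ℂ, ⁅Q ⊗ₜ[ℂ] h, v⁆ = c • v) (l : List ℕ) :
    (⁅P ⊗ₜ[ℂ] e, word P f v l⁆, -((l.length : ℂ) * (l.length - 1))) ∈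
      markedWords P f v (l.length - 1) (l.sum + 1) := by
  induction l with
  | nil =>
    convert Submodule.zero_mem (markedWords P f v 0 1) using 1
    · simp
    · exact Prod.ext (by simp [word, he]) (by simp)
  | cons k l ih =>
    have h2 := h_lie_word_mem (P := P) (v := v) hhf hh k l
    have h1 : (⁅(P ^ k) ⊗ₜ[ℂ] f, ⁅P ⊗ₜ[ℂ] e, word P f v l⁆⁆,
        -((l.length : ℂ) * (l.length - 1))) ∈ markedWords P f v l.length (l.sum + (k + 1)) := by
      -- The empty word is separate because the length `0 - 1` truncates to `0` in the induction
      -- hypothesis; there the vector is zero.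
      rcases l with _ | ⟨j, l⟩
      · convert Submodule.zero_mem (markedWords P f v 0 (k + 1)) using 1
        · simp
        · exact Prod.ext (by simp [word, he]) (by simp)
      · convert lie_mem_markedWords ih k using 1
        rw [List.sum_cons]
        congr 1
        omega
    convert add_mem h2 h1 using 1
    · rw [List.sum_cons, List.length_cons, Nat.add_sub_cancel]
      congr 1
      omega
    · ext
      · simp only [word, Prod.mk_add_mk]
        rw [tmul_lie_tmul_lie, hef, ← pow_succ']
      · simp only [List.length_cons, Prod.mk_add_mk]
        push_cast
        ring

lemma e_lie_mem_markedWords (hef : ⁅e, f⁆ = h) (hhf : ⁅h, f⁆ = -(2 : ℂ) • f)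
    (he : ⁅P ⊗ₜ[ℂ] e, v⁆ = 0) (hh : ∀ Q : A, ∃ c : ℂ, ⁅Q ⊗ₜ[ℂ] h, v⁆ = c • v) {d s : ℕ} {w : V}
    {c : ℂ} (hw : (w, c) ∈ markedWords P f v d s) :
    (⁅P ⊗ₜ[ℂ] e, w⁆, -((d : ℂ) * (d - 1)) * c) ∈ markedWords P f v (d - 1) (s + 1) := by
  suffices markedWords P f v d s ≤ (markedWords P f v (d - 1) (s + 1)).comap
      ((LieModule.toEnd ℂ (A ⊗[ℂ] g) V (P ⊗ₜ[ℂ] e)).prodMap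
        (LinearMap.mulLeft ℂ (-((d : ℂ) * (d - 1))))) from this hw
  refine Submodule.span_le.mpr ?_
  rintro _ ⟨l, rfl, hl, rfl⟩
  have key := e_lie_word_mem hef hhf he hh l
  simp only [Submodule.comap_coe, Set.mem_preimage, LinearMap.prodMap_apply,
    LieModule.toEnd_apply_apply, LinearMap.mulLeft_apply, SetLike.mem_coe]
  rcases hl.eq_or_lt with rfl | hl
  · simpa using key
  · simpa [hl.ne] using markedWords_of_lt (by omega : l.sum + 1 < s + 1) key

/-- Each application removes one letter and raises the total exponent by one. The words it acts on
have length at least `2`, so the factors `-d (d - 1)` never vanish. -/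
lemma exists_pow_e_mem_markedWords (hef : ⁅e, f⁆ = h) (hhf : ⁅h, f⁆ = -(2 : ℂ) • f)
    (he : ⁅P ⊗ₜ[ℂ] e, v⁆ = 0) (hh : ∀ Q : A, ∃ c : ℂ, ⁅Q ⊗ₜ[ℂ] h, v⁆ = c • v) (j m : ℕ) :
    ∃ c : ℂ, c ≠ 0 ∧ ((LieModule.toEnd ℂ (A ⊗[ℂ] g) V (P ⊗ₜ[ℂ] e) ^ j)
      (word P f v (List.replicate (j + m + 1) 0)), c) ∈ markedWords P f v (m + 1) j := by
  induction j generalizing m with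
  | zero =>
    refine ⟨1, one_ne_zero, ?_⟩
    simpa using word_mem_markedWords (P := P) (f := f) (v := v) (List.replicate (0 + m + 1) 0)
      (d := m + 1) (s := 0) (by simp) (by simp)
  | succ j ih =>
    obtain ⟨c, hc, hm⟩ := ih (m + 1)
    refine ⟨-(((m + 1 + 1 : ℕ) : ℂ) * ((m + 1 + 1 : ℕ) - 1)) * c, ?_, ?_⟩
    · rw [Nat.cast_succ, add_sub_cancel_right]
      exact mul_ne_zero (neg_ne_zero.mpr (mul_ne_zero (Nat.cast_add_one_ne_zero _)
        (Nat.cast_ne_zero.mpr m.succ_ne_zero))) hc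
    · rw [pow_succ', Module.End.mul_apply, show j + 1 + m + 1 = j + (m + 1) + 1 by omega]
      have h1 := e_lie_mem_markedWords hef hhf he hh hm
      rwa [Nat.add_sub_cancel] at h1

omit [LieModule ℂ (A ⊗[ℂ] g) V] in
lemma sub_smul_mem_of_mem_markedWords_one {n : ℕ} {w : V} {c : ℂ}
    (hw : (w, c) ∈ markedWords P f v 1 n) :
    w - c • ⁅(P ^ n) ⊗ₜ[ℂ] f, v⁆ ∈
      Submodule.span ℂ ((fun k : ℕ ↦ ⁅(P ^ k) ⊗ₜ[ℂ] f, v⁆) '' Set.Iio n) := by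
  suffices markedWords P f v 1 n ≤ (Submodule.span ℂ
      ((fun k : ℕ ↦ ⁅(P ^ k) ⊗ₜ[ℂ] f, v⁆) '' Set.Iio n)).comap
      (LinearMap.fst ℂ V ℂ - (LinearMap.snd ℂ V ℂ).smulRight ⁅(P ^ n) ⊗ₜ[ℂ] f, v⁆) from this hw
  refine Submodule.span_le.mpr ?_
  rintro _ ⟨l, hl, hs, rfl⟩
  obtain ⟨k, rfl⟩ := List.length_eq_one_iff.mp hl
  rw [List.sum_singleton] at hs
  rcases hs.eq_or_lt with rfl | hk
  · simp [word]
  · have h1 : ⁅(P ^ k) ⊗ₜ[ℂ] f, v⁆ ∈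
        Submodule.span ℂ ((fun k : ℕ ↦ ⁅(P ^ k) ⊗ₜ[ℂ] f, v⁆) '' Set.Iio n) :=
      Submodule.subset_span ⟨k, hk, rfl⟩
    simpa [word, hk.ne] using h1

/-- If `f` acts nilpotently on a highest weight vector `v` for the current algebra of an
`sl₂`-triple, then for every `P` some monic polynomial `p` satisfies `(p(P) ⊗ f) v = 0`. -/
lemma exists_monic_aeval_tmul_lie_eq_zero (hef : ⁅e, f⁆ = h) (hhf : ⁅h, f⁆ = -(2 : ℂ) • f)
    (he : ⁅P ⊗ₜ[ℂ] e, v⁆ = 0) (hh : ∀ Q : A, ∃ c : ℂ, ⁅Q ⊗ₜ[ℂ] h, v⁆ = c • v) {n : ℕ}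
    (hn : (LieModule.toEnd ℂ (A ⊗[ℂ] g) V ((1 : A) ⊗ₜ[ℂ] f) ^ n) v = 0) :
    ∃ p : Polynomial ℂ, p.Monic ∧ ⁅(Polynomial.aeval P p) ⊗ₜ[ℂ] f, v⁆ = 0 := by
  have hword (m : ℕ) : word P f v (List.replicate m 0) =
      (LieModule.toEnd ℂ (A ⊗[ℂ] g) V ((1 : A) ⊗ₜ[ℂ] f) ^ m) v := by
    induction m with
    | zero => rfl
    | succ m ih => simp [List.replicate_succ, word, ih, pow_succ']
  obtain ⟨c, hc, hm⟩ := exists_pow_e_mem_markedWords (P := P) (v := v) hef hhf he hh n 0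
  -- With `n + 1` letters and `n` raising steps one letter remains, so `0` equals `c (P ^ n ⊗ f) v`
  -- plus lower powers of `P`, with `c ≠ 0`.
  rw [hword, add_zero, pow_succ', Module.End.mul_apply, hn, map_zero, map_zero] at hm
  have h1 := sub_smul_mem_of_mem_markedWords_one hm
  rw [zero_sub, neg_mem_iff, Submodule.smul_mem_iff _ hc] at h1
  let ψ : Polynomial ℂ →ₗ[ℂ] V :=
    ((LieModule.toEnd ℂ (A ⊗[ℂ] g) V : A ⊗[ℂ] g →ₗ[ℂ] Module.End ℂ V).flip v) ∘ₗ
      ((TensorProduct.mk ℂ A g).flip f) ∘ₗ (Polynomial.aeval P).toLinearMap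
  have hψ (p : Polynomial ℂ) : ψ p = ⁅(Polynomial.aeval P p) ⊗ₜ[ℂ] f, v⁆ := rfl
  have h2 : Submodule.span ℂ ((fun k : ℕ ↦ ⁅(P ^ k) ⊗ₜ[ℂ] f, v⁆) '' Set.Iio n) ≤
      (Polynomial.degreeLT ℂ n).map ψ := by
    rw [Submodule.span_le]
    rintro _ ⟨k, hk, rfl⟩
    refine ⟨Polynomial.X ^ k, ?_, by simp [hψ]⟩
    rw [SetLike.mem_coe, Polynomial.mem_degreeLT, Polynomial.degree_X_pow]
    exact_mod_cast hk
  obtain ⟨q, hq, hq'⟩ := h2 h1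
  refine ⟨Polynomial.X ^ n - q, ?_, ?_⟩
  · exact Polynomial.monic_X_pow_sub (Polynomial.mem_degreeLT.mp hq)
  · rw [← hψ, map_sub, hq', hψ]
    simp

end CurrentSl2

/-! ### Finite-dimensionality of integrable highest weight modules -/

section FiniteDimensional

variable {g : Type*} [LieRing g] [LieAlgebra ℂ g] [FiniteDimensional ℂ g] [IsKilling ℂ g]
  {H : LieSubalgebra ℂ g} [H.IsCartanSubalgebra]
  {A : Type*} [CommRing A] [Algebra ℂ A]
  {V : Type*} [AddCommGroup V] [Module ℂ V] [LieRingModule (A ⊗[ℂ] g) V]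
  [LieModule ℂ (A ⊗[ℂ] g) V] {b : (rootSystem H).Base} {lam : Dual ℂ H} {v : V}

/-- If `v` is an eigenvector of all `Q ⊗ h`, where `[h, f]` is a nonzero multiple of `f`, then the
elements `P` of `A` with `(P ⊗ f) v = 0` form an ideal. -/
def lieAnnihilator {g A V : Type*} [LieRing g] [LieAlgebra ℂ g] [CommRing A] [Algebra ℂ A]
    [AddCommGroup V] [Module ℂ V] [LieRingModule (A ⊗[ℂ] g) V] [LieModule ℂ (A ⊗[ℂ] g) V]
    {f h : g} {v : V} (hhf : ⁅h, f⁆ = -(2 : ℂ) • f)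
    (hh : ∀ Q : A, ∃ c : ℂ, ⁅Q ⊗ₜ[ℂ] h, v⁆ = c • v) : Ideal A where
  carrier := {P | ⁅P ⊗ₜ[ℂ] f, v⁆ = 0}
  zero_mem' := by simp
  add_mem' {P Q} hP hQ := by
    simp only [Set.mem_ofPred_eq] at hP hQ ⊢
    rw [TensorProduct.add_tmul, add_lie, hP, hQ, add_zero]
  smul_mem' Q P hP := by
    simp only [Set.mem_ofPred_eq, smul_eq_mul] at hP ⊢
    obtain ⟨c, hc⟩ := hh Q
    -- `[Q ⊗ h, P ⊗ f] = -2 (QP ⊗ f)`, and both products on the left kill `v`.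
    have := tmul_lie_tmul_lie Q P h f v
    rw [hP, lie_zero, hc, lie_smul, hP, smul_zero, add_zero, hhf, TensorProduct.tmul_smul, smul_lie,
      eq_comm, smul_eq_zero] at this
    exact this.resolve_left (by norm_num)

lemma IsHighestWeightGenerator.exists_ideal [Algebra.FiniteType ℂ A]
    (hv : IsHighestWeightGenerator (A := A) b lam v) (hV : IsIntegrable H A V) :
    ∃ J : Ideal A, Module.Finite ℂ (A ⧸ J) ∧
      ∀ P ∈ J, ∀ (x : g) (w : V), ⁅P ⊗ₜ[ℂ] x, w⁆ = 0 := by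
  classical
  choose e f he hf hef using exists_sl2 (H := H)
  have hhf (α : H.root) : ⁅((rootSystem H).coroot α : g), f α⁆ = -(2 : ℂ) • f α := by
    have h1 : (rootSystem H).root α ((rootSystem H).coroot α) = 2 :=
      root_apply_coroot (H.isNonZero_coe_root α)
    have := lie_eq_smul_of_mem_rootSpace (hf α) ((rootSystem H).coroot α)
    rw [LinearMap.neg_apply, h1] at this
    exact this
  have hspan (α : H.root) {x : g} (hx : x ∈ rootSpace H (-(rootSystem H).root α : Dual ℂ H)) :
      ∃ c : ℂ, x = c • f α := by
    have hf0 : f α ≠ 0 := by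
      intro h0
      have h1 := hef α
      rw [h0, lie_zero] at h1
      exact (rootSystem H).flip.ne_zero α (Subtype.ext h1.symm)
    have h1 := finrank_rootSpace_eq_one (-(α : LieModule.Weight ℂ H g))
      (H.isNonZero_coe_root α).neg
    obtain ⟨c, hc⟩ := (finrank_eq_one_iff_of_nonzero' (⟨f α, hf α⟩ :
      rootSpace H (-(α : LieModule.Weight ℂ H g)))
        (fun h0 ↦ hf0 (congrArg Subtype.val h0))).mp h1 ⟨x, hx⟩
    exact ⟨c, congrArg Subtype.val hc.symm⟩
  have hh (α : H.root) (Q : A) := hv.cartan_lie Q ((rootSystem H).coroot α)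
  have heP {α : H.root} (hα : b.IsPos α) (P : A) : ⁅P ⊗ₜ[ℂ] e α, v⁆ = 0 :=
    hv.nPlus_lie P _ (Submodule.mem_iSup_of_mem α (Submodule.mem_iSup_of_mem hα (he α)))
  let I (α : H.root) : Ideal A := lieAnnihilator (hhf α) (hh α)
  let J : Ideal A := ⨅ (α : H.root) (_ : b.IsPos α), I α
  refine ⟨J, ?_, ?_⟩
  -- The value `1` at the other roots allows one product over all roots to serve as the integral
  -- equation of `P` modulo `J`.
  · have hmon (P : A) (α : H.root) : ∃ p : Polynomial ℂ, p.Monic ∧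
        (b.IsPos α → Polynomial.aeval P p ∈ I α) := by
      by_cases hα : b.IsPos α
      · obtain ⟨n, hn⟩ := hV.exists_pow_eq_zero (neg_ne_zero.mpr ((rootSystem H).ne_zero α)) (hf α)
          1 hv.mem_weightSpace
        obtain ⟨p, hp, hp'⟩ := exists_monic_aeval_tmul_lie_eq_zero (P := P) (hef α) (hhf α)
          (heP hα P) (hh α) hn
        exact ⟨p, hp, fun _ ↦ hp'⟩
      · exact ⟨1, Polynomial.monic_one, fun h ↦ absurd h hα⟩
    have : Algebra.IsIntegral ℂ (A ⧸ J) := by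
      refine ⟨fun x ↦ ?_⟩
      obtain ⟨P, rfl⟩ := Ideal.Quotient.mk_surjective x
      choose p hp hp' using hmon P
      refine ⟨∏ α, p α, Polynomial.monic_prod_of_monic _ _ fun α _ ↦ hp α, ?_⟩
      rw [← Polynomial.aeval_def]
      change Polynomial.aeval (Ideal.Quotient.mkₐ ℂ J P) _ = 0
      rw [Polynomial.aeval_algHom_apply]
      change Ideal.Quotient.mk J _ = 0
      rw [Ideal.Quotient.eq_zero_iff_mem]
      simp only [J, Submodule.mem_iInf]
      intro α hα
      rw [map_prod, ← Finset.mul_prod_erase _ _ (Finset.mem_univ α)]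
      exact Ideal.mul_mem_right _ _ (hp' α hα)
    exact Algebra.IsIntegral.finite
  · have hJ {P : A} (hP : P ∈ J) {α : H.root} (hα : b.IsPos α) : ⁅P ⊗ₜ[ℂ] f α, v⁆ = 0 := by
      simp only [J, Submodule.mem_iInf] at hP
      exact hP α hα
    have hJv {P : A} (hP : P ∈ J) (x : g) : ⁅P ⊗ₜ[ℂ] x, v⁆ = 0 := by
      -- `P ⊗ h_i = [1 ⊗ e_i, P ⊗ f_i]`, and both factors kill `v`.
      have hcoroot (i : H.root) (hi : i ∈ b.support) :
          ⁅P ⊗ₜ[ℂ] ((rootSystem H).coroot i : g), v⁆ = 0 := by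
        have hpos := RootPairing.Base.isPos_of_mem_support hi
        have := tmul_lie_tmul_lie (1 : A) P (e i) (f i) v
        rwa [hJ hP hpos, heP hpos, lie_zero, lie_zero, add_zero, hef, one_mul, eq_comm] at this
      have hx : x ∈ ⨆ α : LieModule.Weight ℂ H g, (rootSpace H α).toSubmodule := by
        rw [← LieSubmodule.iSup_toSubmodule, LieModule.iSup_genWeightSpace_eq_top' ℂ H g]
        trivial
      induction hx using Submodule.iSup_induction' with
      | zero => simp
      | add x y _ _ hx hy => rw [TensorProduct.tmul_add, add_lie, hx, hy, add_zero]
      | mem α x hx =>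
        by_cases hα : α.IsZero
        · have hxH : x ∈ H := by
            rw [LieSubmodule.mem_toSubmodule, hα.eq, rootSpace_zero_eq] at hx
            simpa using hx
          have hxs : (⟨x, hxH⟩ : H) ∈
              Submodule.span ℂ ((rootSystem H).coroot '' b.support) := by
            rw [b.span_coroot_support, RootPairing.corootSpan,
              RootPairing.IsRootSystem.span_coroot_eq_top]
            trivial
          suffices ∀ y : H, y ∈ Submodule.span ℂ ((rootSystem H).coroot '' b.support) →
            ⁅P ⊗ₜ[ℂ] (y : g), v⁆ = 0 from this _ hxs
          intro y hy
          induction hy using Submodule.span_induction with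
          | mem y hy =>
            obtain ⟨i, hi, rfl⟩ := hy
            exact hcoroot i hi
          | zero => simp
          | add y z _ _ hy hz =>
            rw [H.coe_add, TensorProduct.tmul_add, add_lie, hy, hz, add_zero]
          | smul c y _ hy => rw [H.coe_smul, TensorProduct.tmul_smul, smul_lie, hy, smul_zero]
        · let i : H.root := ⟨α, by simpa using hα⟩
          obtain h | h : b.IsPos i ∨ b.IsPos ((rootSystem H).reflectionPerm i i) :=
            RootPairing.Base.IsPos.or_neg b i
          · exact hv.nPlus_lie P x (Submodule.mem_iSup_of_mem i (Submodule.mem_iSup_of_mem h hx))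
          · obtain ⟨c, rfl⟩ := hspan ((rootSystem H).reflectionPerm i i) (x := x) (by
              rw [RootPairing.root_reflectionPerm, RootPairing.reflection_apply_self, neg_neg]
              exact hx)
            rw [TensorProduct.tmul_smul, smul_lie, hJ hP h, smul_zero]
    -- The vectors killed by `J ⊗ g` form a submodule because `J ⊗ g` is an ideal of `A ⊗ g`; it
    -- contains the generator `v`.
    let N : LieSubmodule ℂ (A ⊗[ℂ] g) V :=
      { carrier := {w | ∀ P ∈ J, ∀ x : g, ⁅P ⊗ₜ[ℂ] x, w⁆ = 0}
        zero_mem' := by simp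
        add_mem' := by
          intro w w' hw hw' P hP x
          rw [lie_add, hw P hP x, hw' P hP x, add_zero]
        smul_mem' := by
          intro c w hw P hP x
          rw [lie_smul, hw P hP x, smul_zero]
        lie_mem := by
          intro l w hw P hP x
          change ∀ P ∈ J, ∀ x : g, ⁅P ⊗ₜ[ℂ] x, w⁆ = 0 at hw
          induction l using TensorProduct.induction_on with
          | zero => simp
          | add l l' hl hl' => rw [add_lie, lie_add, hl, hl', add_zero]
          | tmul Q y =>
            rw [tmul_lie_tmul_lie, hw _ (Ideal.mul_mem_right Q J hP), hw P hP, lie_zero,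
              add_zero] }
    have hN : N = ⊤ := by
      rw [eq_top_iff, ← hv.lieSpan_eq_top, LieSubmodule.lieSpan_le, Set.singleton_subset_iff]
      exact fun P hP x ↦ hJv hP x
    intro P hP x w
    have hw : w ∈ N := hN ▸ LieSubmodule.mem_top w
    exact hw P hP x

omit [IsKilling ℂ g] in
lemma fg_range_toEnd {J : Ideal A} [Module.Finite ℂ (A ⧸ J)]
    (hJ : ∀ P ∈ J, ∀ (x : g) (w : V), ⁅P ⊗ₜ[ℂ] x, w⁆ = 0) :
    (LinearMap.range (LieModule.toEnd ℂ (A ⊗[ℂ] g) V : A ⊗[ℂ] g →ₗ[ℂ] Module.End ℂ V)).FG := by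
  let φ : A →ₗ[ℂ] g →ₗ[ℂ] Module.End ℂ V := TensorProduct.curry
    (LieModule.toEnd ℂ (A ⊗[ℂ] g) V : A ⊗[ℂ] g →ₗ[ℂ] Module.End ℂ V)
  let ψ : (A ⧸ J) →ₗ[ℂ] g →ₗ[ℂ] Module.End ℂ V :=
    (J.restrictScalars ℂ).liftQ φ fun P hP ↦ by
      ext x w
      exact hJ P hP x w
  have h1 := Submodule.FG.map₂ ψ (Module.Finite.fg_top (R := ℂ) (M := A ⧸ J))
    (Module.Finite.fg_top (R := ℂ) (M := g))
  have h2 : LinearMap.range (LieModule.toEnd ℂ (A ⊗[ℂ] g) V : A ⊗[ℂ] g →ₗ[ℂ] Module.End ℂ V) ≤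
      Submodule.map₂ ψ ⊤ ⊤ := by
    rintro _ ⟨y, rfl⟩
    induction y using TensorProduct.induction_on with
    | zero => simp
    | add x y hx hy => rw [map_add]; exact add_mem hx hy
    | tmul P x =>
      exact Submodule.apply_mem_map₂ ψ (m := Ideal.Quotient.mk J P) (n := x) trivial trivial
  have := Module.Finite.iff_fg.mpr h1
  exact Module.Finite.iff_fg.mp (Submodule.finiteDimensional_of_le h2)

lemma IsHighestWeightGenerator.finiteDimensional [Algebra.FiniteType ℂ A]
    (hv : IsHighestWeightGenerator (A := A) b lam v) (hV : IsIntegrable H A V) :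
    FiniteDimensional ℂ V := by
  obtain ⟨J, hfin, hJ⟩ := hv.exists_ideal hV
  have hfg := fg_range_toEnd hJ
  have hlevel (k : ℕ) : FiniteDimensional ℂ (level A b v k) := by
    induction k with
    | zero => exact Module.Finite.iff_fg.mpr (Submodule.fg_span_singleton v)
    | succ k ih =>
      have h1 := Submodule.FG.map₂ (LinearMap.id : Module.End ℂ V →ₗ[ℂ] V →ₗ[ℂ] V) hfg
        (Module.Finite.iff_fg.mp ih)
      have := Module.Finite.iff_fg.mpr h1
      refine Submodule.finiteDimensional_of_le (Submodule.map₂_le.mpr fun y _ w hw ↦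
        Submodule.apply_mem_map₂ (LinearMap.id : Module.End ℂ V →ₗ[ℂ] V →ₗ[ℂ] V)
          (LinearMap.mem_range_self
            (LieModule.toEnd ℂ (A ⊗[ℂ] g) V : A ⊗[ℂ] g →ₗ[ℂ] Module.End ℂ V) y) hw)
  obtain ⟨D, hD, -, hDtop⟩ := isIntegrable_iff.mp hV
  -- Level `k` involves only weights at height at least `k` below `lam`, while the heights occurring
  -- in the finite set `D` are bounded.
  obtain ⟨K, hK⟩ : ∃ K : ℕ, ∀ k ≥ K, level A b v k = ⊥ := by
    obtain ⟨M, hM⟩ := (hD.image fun μ ↦ ‖heightFunctional b (lam - μ)‖).bddAbove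
    refine ⟨⌊M⌋₊ + 1, fun k hk ↦ ?_⟩
    rw [eq_bot_iff]
    refine (hv.level_le k).trans (iSup₂_le fun μ hμ ↦ ?_)
    by_contra hne
    have h1 := hM ⟨μ, mem_of_weightSpace_ne_bot hDtop (fun h ↦ hne h.le), rfl⟩
    obtain ⟨-, n, hn, h2⟩ := hμ
    simp only [h2, Complex.norm_natCast] at h1
    have := Nat.le_floor h1
    omega
  have htop : ⨆ k : Fin K, level A b v k = ⊤ := by
    rw [eq_top_iff, ← hv.iSup_level_eq_top, iSup_le_iff]
    intro k
    by_cases hk : k < K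
    · exact le_iSup (fun k : Fin K ↦ level A b v k) ⟨k, hk⟩
    · rw [hK k (not_lt.mp hk)]
      exact bot_le
  have : FiniteDimensional ℂ (⊤ : Submodule ℂ V) := htop ▸ Submodule.finiteDimensional_iSup _
  exact Module.Finite.iff_fg.mp this |> fun h ↦ ⟨h⟩

end FiniteDimensional

end WeylModules

namespace WeylModules

open LieAlgebra LieAlgebra.IsKilling Module

/-! ### Cyclic modules -/

namespace CyclicModule

section General

attribute [local instance] LieRing.ofAssociativeRing

variable {L : Type*} [LieRing L] [LieAlgebra ℂ L]
  {K : Submodule (UniversalEnvelopingAlgebra ℂ L) (UniversalEnvelopingAlgebra ℂ L)}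
  {V : Type*} [AddCommGroup V] [Module ℂ V] [LieRingModule L V] [LieModule ℂ L V]

variable (L V) in
/-- The action of the enveloping algebra on a Lie module. -/
noncomputable def envelopingAction : UniversalEnvelopingAlgebra ℂ L →ₐ[ℂ] Module.End ℂ V :=
  UniversalEnvelopingAlgebra.lift ℂ (LieModule.toEnd ℂ L V)

lemma envelopingAction_ι (x : L) (w : V) :
    envelopingAction L V (UniversalEnvelopingAlgebra.ι ℂ x) w = ⁅x, w⁆ := by
  rw [envelopingAction, UniversalEnvelopingAlgebra.lift_ι_apply, LieModule.toEnd_apply_apply]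

lemma envelopingAction_eq_smul (x : UniversalEnvelopingAlgebra ℂ L) (w : CyclicModule K) :
    envelopingAction L (CyclicModule K) x w = x • w := by
  have : envelopingAction L (CyclicModule K) = Algebra.lsmul ℂ ℂ (CyclicModule K) := by
    apply UniversalEnvelopingAlgebra.hom_ext
    refine LieHom.ext fun x ↦ LinearMap.ext fun w ↦ ?_
    exact envelopingAction_ι x w
  rw [this]
  rfl

/-- The left ideal of the elements of the enveloping algebra that kill `u`. -/
noncomputable def annihilator (u : V) :
    Submodule (UniversalEnvelopingAlgebra ℂ L) (UniversalEnvelopingAlgebra ℂ L) where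
  carrier := {x | envelopingAction L V x u = 0}
  zero_mem' := by simp
  add_mem' {x y} hx hy := by
    rw [Set.mem_ofPred_eq] at hx hy ⊢
    rw [map_add, LinearMap.add_apply, hx, hy, add_zero]
  smul_mem' c x hx := by
    rw [Set.mem_ofPred_eq] at hx ⊢
    rw [smul_eq_mul, map_mul, Module.End.mul_apply, hx, map_zero]

lemma mem_annihilator {u : V} {x : UniversalEnvelopingAlgebra ℂ L} :
    x ∈ annihilator u ↔ envelopingAction L V x u = 0 := Iff.rfl

/-- The homomorphism `U(L) / K → V` taking the class of `1` to a vector `u` killed by `K`. -/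
noncomputable def liftHom (u : V) (hK : K ≤ annihilator u) : CyclicModule K →ₗ⁅ℂ, L⁆ V :=
  { (K.restrictScalars ℂ).liftQ ((envelopingAction L V).toLinearMap.flip u) fun _ hx ↦ hK hx with
    map_lie' := by
      intro x m
      obtain ⟨y, rfl⟩ := Submodule.Quotient.mk_surjective K m
      change envelopingAction L V (UniversalEnvelopingAlgebra.ι ℂ x * y) u =
        ⁅x, envelopingAction L V y u⁆
      rw [map_mul, Module.End.mul_apply, envelopingAction_ι] }

lemma liftHom_mk (u : V) (hK : K ≤ annihilator u) (x : UniversalEnvelopingAlgebra ℂ L) :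
    liftHom u hK (Submodule.Quotient.mk x : UniversalEnvelopingAlgebra ℂ L ⧸ K) =
      envelopingAction L V x u := rfl

lemma liftHom_gen (u : V) (hK : K ≤ annihilator u) : liftHom u hK (gen K) = u := by
  rw [gen, liftHom_mk, map_one, Module.End.one_apply]

lemma liftHom_injective (u : V) : Function.Injective (liftHom (L := L) u le_rfl) := by
  rw [injective_iff_map_eq_zero]
  intro m hm
  obtain ⟨x, rfl⟩ := Submodule.Quotient.mk_surjective _ m
  exact (Submodule.Quotient.mk_eq_zero _).mpr hm

lemma liftHom_surjective (u : V) (hK : K ≤ annihilator u)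
    (hu : LieSubmodule.lieSpan ℂ L {u} = ⊤) : Function.Surjective (liftHom u hK) := by
  rw [← LieModuleHom.range_eq_top, eq_top_iff, ← hu, LieSubmodule.lieSpan_le,
    Set.singleton_subset_iff]
  exact ⟨gen K, liftHom_gen u hK⟩

/-- What has to be seen is that a Lie submodule is stable under all of `U(L)`. The elements whose
action on `N` is multiplication form a subalgebra containing the image of `L`. -/
lemma lieSpan_gen : LieSubmodule.lieSpan ℂ L {gen K} = ⊤ := by
  set N := LieSubmodule.lieSpan ℂ L {gen K}
  have hgen : gen K ∈ N := LieSubmodule.subset_lieSpan rfl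
  have key (x : UniversalEnvelopingAlgebra ℂ L) (n : N) :
      ((envelopingAction L N x n : N) : CyclicModule K) = x • (n : CyclicModule K) := by
    let S : Subalgebra ℂ (UniversalEnvelopingAlgebra ℂ L) :=
      { carrier := {x | ∀ n : N,
          ((envelopingAction L N x n : N) : CyclicModule K) = x • (n : CyclicModule K)}
        mul_mem' := by
          intro x y hx hy n
          rw [map_mul, Module.End.mul_apply, hx, hy, mul_smul]
        add_mem' := by
          intro x y hx hy n
          rw [map_add, LinearMap.add_apply, add_smul, ← hx, ← hy]; rfl
        algebraMap_mem' := by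
          intro c n
          rw [AlgHom.commutes, algebraMap_smul]; rfl }
    let φ : L →ₗ⁅ℂ⁆ S :=
      { toFun := fun x ↦ ⟨UniversalEnvelopingAlgebra.ι ℂ x, fun n ↦ by
          rw [envelopingAction_ι]; rfl⟩
        map_add' := fun x y ↦ Subtype.ext (map_add _ x y)
        map_smul' := fun c x ↦ Subtype.ext (map_smul _ c x)
        map_lie' := fun {x y} ↦ Subtype.ext (LieHom.map_lie _ x y) }
    -- By the universal property the identity of `U(L)` factors through `S`, so `S` is everything.
    have h1 : S.val.comp (UniversalEnvelopingAlgebra.lift ℂ φ) = AlgHom.id ℂ _ := by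
      apply UniversalEnvelopingAlgebra.hom_ext
      refine LieHom.ext fun x ↦ ?_
      change ((UniversalEnvelopingAlgebra.lift ℂ φ (UniversalEnvelopingAlgebra.ι ℂ x) : S) :
        UniversalEnvelopingAlgebra ℂ L) = _
      rw [UniversalEnvelopingAlgebra.lift_ι_apply]
      rfl
    have h2 : x ∈ S := by
      have := AlgHom.congr_fun h1 x
      rw [AlgHom.id_apply] at this
      rw [← this]
      exact Subtype.property _
    exact h2 n
  rw [eq_top_iff]
  intro m _
  obtain ⟨x, rfl⟩ := Submodule.Quotient.mk_surjective K m
  have h1 := (envelopingAction L N x ⟨gen K, hgen⟩).property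
  rw [key] at h1
  have h2 : (Submodule.Quotient.mk (x • 1) : UniversalEnvelopingAlgebra ℂ L ⧸ K) ∈ N := h1
  rwa [smul_eq_mul, mul_one] at h2

lemma annihilator_gen : annihilator (gen K) = K := by
  ext x
  rw [mem_annihilator, envelopingAction_eq_smul]
  change (Submodule.Quotient.mk (x • 1) : UniversalEnvelopingAlgebra ℂ L ⧸ K) = 0 ↔ _
  rw [smul_eq_mul, mul_one, Submodule.Quotient.mk_eq_zero]

end General

end CyclicModule

variable {g : Type*} [LieRing g] [LieAlgebra ℂ g] [FiniteDimensional ℂ g] [IsKilling ℂ g]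
  {H : LieSubalgebra ℂ g} [H.IsCartanSubalgebra]
  {A : Type*} [CommRing A] [Algebra ℂ A]

/-! ### Integrability along isomorphisms. -/

section Transfer

variable {V W : Type*} [AddCommGroup V] [Module ℂ V] [LieRingModule (A ⊗[ℂ] g) V]
  [LieModule ℂ (A ⊗[ℂ] g) V] [AddCommGroup W] [Module ℂ W] [LieRingModule (A ⊗[ℂ] g) W]
  [LieModule ℂ (A ⊗[ℂ] g) W]

omit [FiniteDimensional ℂ g] [IsKilling ℂ g] [H.IsCartanSubalgebra] in
lemma map_mem_weightSpace (φ : W →ₗ⁅ℂ, A ⊗[ℂ] g⁆ V) {μ : Dual ℂ H} {w : W}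
    (hw : w ∈ weightSpace H A W μ) : φ w ∈ weightSpace H A V μ := fun h ↦ by
  rw [← LieModuleHom.map_lie, hw h, map_smul]

lemma IsIntegrable.of_bijective (hV : IsIntegrable H A V) (φ : W →ₗ⁅ℂ, A ⊗[ℂ] g⁆ V)
    (hφ : Function.Bijective φ) : IsIntegrable H A W := by
  obtain ⟨D, hfin, hD, htop⟩ := isIntegrable_iff.mp hV
  refine isIntegrable_iff.mpr ⟨D, hfin, hD, ?_⟩
  have hle (μ : Dual ℂ H) :
      weightSpace H A V μ ≤ (weightSpace H A W μ).map (φ : W →ₗ[ℂ] V) := by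
    intro x hx
    obtain ⟨w, rfl⟩ := hφ.2 x
    refine ⟨w, fun h ↦ hφ.1 ?_, rfl⟩
    rw [LieModuleHom.map_lie, hx h, map_smul]
  have h1 : (⨆ μ ∈ D, weightSpace H A W μ).map (φ : W →ₗ[ℂ] V) = ⊤ := by
    rw [eq_top_iff, ← htop]
    simp only [Submodule.map_iSup]
    exact iSup₂_mono fun μ _ ↦ hle μ
  rw [eq_top_iff]
  intro w _
  obtain ⟨w', hw', h2⟩ : φ w ∈ (⨆ μ ∈ D, weightSpace H A W μ).map (φ : W →ₗ[ℂ] V) := by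
    rw [h1]; trivial
  rwa [← hφ.1 h2]

end Transfer

/-! ### The local Weyl module -/

namespace LambdaMultiset

variable {b : (rootSystem H).Base} {lam : Dual ℂ H} {Z : LambdaMultiset A b lam}

/-- This is why the generator has weight `lam` over `1 ⊗ H`. -/
lemma scalar_one (Z : LambdaMultiset A b lam) (i : b.support) :
    Z.scalar i 1 = lam ((rootSystem H).coroot i) := by
  simp only [scalar, map_one, Finset.sum_const, Finset.card_univ, Fintype.card_fin, nsmul_eq_mul,
    mul_one]
  exact (Z.apply_coroot i).symm

lemma isHighestWeightGenerator {V : Type*} [AddCommGroup V] [Module ℂ V]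
    [LieRingModule (A ⊗[ℂ] g) V] [LieModule ℂ (A ⊗[ℂ] g) V] {v : V}
    (hspan : LieSubmodule.lieSpan ℂ (A ⊗[ℂ] g) {v} = ⊤)
    (hpos : ∀ (P : A), ∀ x ∈ nPlus b, ⁅P ⊗ₜ[ℂ] x, v⁆ = 0)
    (hcoroot : ∀ (i : b.support) (P : A),
      ⁅P ⊗ₜ[ℂ] ((rootSystem H).coroot i : g), v⁆ = Z.scalar i P • v) :
    IsHighestWeightGenerator (A := A) b lam v := by
  have htop : Submodule.span ℂ ((rootSystem H).coroot '' b.support) = ⊤ := by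
    rw [b.span_coroot_support, RootPairing.corootSpan,
      RootPairing.IsRootSystem.span_coroot_eq_top]
  refine ⟨hspan, hpos, fun P h ↦ ?_, fun h ↦ ?_⟩
  · have hh : h ∈ Submodule.span ℂ ((rootSystem H).coroot '' b.support) := htop ▸ trivial
    induction hh using Submodule.span_induction with
    | mem y hy =>
      obtain ⟨i, hi, rfl⟩ := hy
      exact ⟨_, hcoroot ⟨i, hi⟩ P⟩
    | zero => exact ⟨0, by simp⟩
    | add y z _ _ hy hz =>
      obtain ⟨c, hc⟩ := hy
      obtain ⟨d, hd⟩ := hz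
      exact ⟨c + d, by rw [H.coe_add, TensorProduct.tmul_add, add_lie, hc, hd, add_smul]⟩
    | smul a y _ hy =>
      obtain ⟨c, hc⟩ := hy
      exact ⟨a * c, by rw [H.coe_smul, TensorProduct.tmul_smul, smul_lie, hc, mul_smul]⟩
  · have hh : h ∈ Submodule.span ℂ ((rootSystem H).coroot '' b.support) := htop ▸ trivial
    induction hh using Submodule.span_induction with
    | mem y hy =>
      obtain ⟨i, hi, rfl⟩ := hy
      rw [hcoroot ⟨i, hi⟩ 1, scalar_one]
    | zero => simp
    | add y z _ _ hy hz =>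
      rw [H.coe_add, TensorProduct.tmul_add, add_lie, hy, hz, map_add, add_smul]
    | smul a y _ hy =>
      rw [H.coe_smul, TensorProduct.tmul_smul, smul_lie, hy, map_smul, smul_eq_mul, mul_smul]

lemma relationIdeal_le_iff {V : Type*} [AddCommGroup V] [Module ℂ V]
    [LieRingModule (A ⊗[ℂ] g) V] [LieModule ℂ (A ⊗[ℂ] g) V] {u : V} :
    Z.relationIdeal ≤ CyclicModule.annihilator u ↔
      (∀ (P : A), ∀ x ∈ nPlus b, ⁅P ⊗ₜ[ℂ] x, u⁆ = 0) ∧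
      ∀ (i : b.support) (P : A),
        ⁅P ⊗ₜ[ℂ] ((rootSystem H).coroot i : g), u⁆ = Z.scalar i P • u := by
  have h1 (P : A) (x : g) : UniversalEnvelopingAlgebra.ι ℂ (P ⊗ₜ[ℂ] x) ∈
      CyclicModule.annihilator u ↔ ⁅P ⊗ₜ[ℂ] x, u⁆ = 0 := by
    rw [CyclicModule.mem_annihilator, CyclicModule.envelopingAction_ι]
  have h2 (P : A) (x : g) (c : ℂ) : UniversalEnvelopingAlgebra.ι ℂ (P ⊗ₜ[ℂ] x) -
      algebraMap ℂ _ c ∈ CyclicModule.annihilator u ↔ ⁅P ⊗ₜ[ℂ] x, u⁆ = c • u := by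
    rw [CyclicModule.mem_annihilator, map_sub, LinearMap.sub_apply,
      CyclicModule.envelopingAction_ι, AlgHom.commutes, Module.algebraMap_end_apply, sub_eq_zero]
  rw [relationIdeal, Submodule.span_le, Set.union_subset_iff]
  refine and_congr ⟨fun h P x hx ↦ (h1 P x).mp (h ⟨P, x, hx, rfl⟩), ?_⟩
    ⟨fun h i P ↦ (h2 P _ _).mp (h ⟨i, P, rfl⟩), ?_⟩
  · rintro h _ ⟨P, x, hx, rfl⟩
    exact (h1 P x).mpr (h P x hx)
  · rintro h _ ⟨i, P, rfl⟩
    exact (h2 P _ _).mpr (h i P)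

lemma isHighestWeightGenerator_gen
    {K : Submodule (UniversalEnvelopingAlgebra ℂ (A ⊗[ℂ] g))
      (UniversalEnvelopingAlgebra ℂ (A ⊗[ℂ] g))} (hK : Z.relationIdeal ≤ K) :
    IsHighestWeightGenerator (A := A) b lam (CyclicModule.gen K) := by
  rw [← CyclicModule.annihilator_gen (K := K), relationIdeal_le_iff] at hK
  exact isHighestWeightGenerator CyclicModule.lieSpan_gen hK.1 hK.2

lemma relationIdeal_le_weylIdeal (Z : LambdaMultiset A b lam) : Z.relationIdeal ≤ Z.weylIdeal :=
  le_sInf fun _ hK ↦ hK.1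

/-- A vector of weight outside `weightBound b lam` maps to zero in every `U / K`, so its
representative lies in every `K` and hence in the intersection. The uniform bound is essential, as
infinitely many `K` may occur. -/
lemma isIntegrable_localWeylModule (hlam : IsDominant b lam) (Z : LambdaMultiset A b lam) :
    IsIntegrable H A Z.LocalWeylModule := by
  refine isIntegrable_iff.mpr ⟨weightBound b lam, finite_weightBound, hlam.weightBound_subset, ?_⟩
  have hgen := isHighestWeightGenerator_gen Z.relationIdeal_le_weylIdeal
  rw [eq_top_iff, ← hgen.iSup_weightSpace_eq_top]
  refine iSup₂_le fun μ _ ↦ ?_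
  by_cases hμ : μ ∈ weightBound b lam
  · exact le_iSup₂_of_le μ hμ le_rfl
  suffices weightSpace H A Z.LocalWeylModule μ = ⊥ by rw [this]; exact bot_le
  rw [Submodule.eq_bot_iff]
  intro w hw
  obtain ⟨x, rfl⟩ := Submodule.Quotient.mk_surjective Z.weylIdeal w
  refine (Submodule.Quotient.mk_eq_zero _).mpr ?_
  refine Submodule.mem_sInf.mpr fun K hK ↦ ?_
  have hle : Z.weylIdeal ≤ CyclicModule.annihilator (CyclicModule.gen K) := by
    rw [CyclicModule.annihilator_gen]
    exact sInf_le hK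
  have h1 := map_mem_weightSpace (CyclicModule.liftHom _ hle) hw
  have h2 : weightSpace H A (CyclicModule K) μ = ⊥ := by
    by_contra hne
    exact hμ ((isHighestWeightGenerator_gen hK.1).mem_weightBound hK.2 hne)
  rw [h2, Submodule.mem_bot, CyclicModule.liftHom_mk, ← CyclicModule.mem_annihilator,
    CyclicModule.annihilator_gen] at h1
  exact h1

/-- `U / annihilator u` is isomorphic to `V`, hence integrable. Passing to this ideal also lets `V`
live in any universe. -/
lemma IsWeylQuotient.weylIdeal_le {V : Type*} [AddCommGroup V] [Module ℂ V]
    [LieRingModule (A ⊗[ℂ] g) V] [LieModule ℂ (A ⊗[ℂ] g) V] {u : V} (hu : Z.IsWeylQuotient V u) :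
    Z.weylIdeal ≤ CyclicModule.annihilator u :=
  sInf_le ⟨relationIdeal_le_iff.mpr ⟨hu.nPlus_lie, hu.coroot_lie⟩,
    hu.integrable.of_bijective (CyclicModule.liftHom u le_rfl)
      ⟨CyclicModule.liftHom_injective u,
        CyclicModule.liftHom_surjective u le_rfl hu.lieSpan_eq_top⟩⟩

end LambdaMultiset

end WeylModules

theorem mainTheorem1 {g : Type*} [LieRing g] [LieAlgebra ℂ g] [FiniteDimensional ℂ g]
    [LieAlgebra.IsSemisimple ℂ g] (H : LieSubalgebra ℂ g) [H.IsCartanSubalgebra]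
    (b : (LieAlgebra.IsKilling.rootSystem H).Base)
    {A : Type*} [CommRing A] [Algebra ℂ A] [Algebra.FiniteType ℂ A]
    (lam : Module.Dual ℂ H) (hlam : WeylModules.IsDominant b lam)
    (Z : WeylModules.LambdaMultiset A b lam) :
    WeylModules.LambdaMultiset.IsLocalWeylModule.{w} Z Z.LocalWeylModule
        (WeylModules.CyclicModule.gen Z.weylIdeal) ∧
      FiniteDimensional ℂ Z.LocalWeylModule := by
  have hint := WeylModules.LambdaMultiset.isIntegrable_localWeylModule hlam Z
  have hle := Z.relationIdeal_le_weylIdeal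
  have hgen := WeylModules.LambdaMultiset.isHighestWeightGenerator_gen hle
  refine ⟨⟨⟨hint, hgen.lieSpan_eq_top, hgen.nPlus_lie, ?_⟩, ?_⟩, hgen.finiteDimensional hint⟩
  · rw [← WeylModules.CyclicModule.annihilator_gen (K := Z.weylIdeal),
      WeylModules.LambdaMultiset.relationIdeal_le_iff] at hle
    exact hle.2
  · intro V _ _ _ _ u hu
    exact ⟨WeylModules.CyclicModule.liftHom u hu.weylIdeal_le,
      WeylModules.CyclicModule.liftHom_surjective u _ hu.lieSpan_eq_top,
      WeylModules.CyclicModule.liftHom_gen u _⟩
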